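/- Let $k$ be an algebraically closed field of any characteristic. An automorphism $f=(f_1,\dots,f_n)$ of $\mathbb{A}^n$ is given by polynomials $f_i\in k[x_1,\dots,x_n]$; put $\deg f=\max_i\deg f_i$. Its dynamical degree is $\lambda(f)=\lim_{m\to\infty}\deg(f^m)^{1/m}$, and $f$ is called algebraically stable if $\deg(f^m)=\deg(f)^m$ for all $m>0$. An automorphism is affine if all its components have degree $1$, triangular if $f_i\in k[x_i,\dots,x_n]$ for all $i$, and affine-triangular if it is the composition $\alpha\circ\tau$ of an affine automorphism $\alpha$ and a triangular automorphism $\tau$. For $\alpha=(\alpha_1,\alpha_2,\alpha_3)$ we write $\alpha^*(x)=\alpha_1$, $\alpha^*(y)=\alpha_2$, $\alpha^*(z)=\alpha_3$. **Proposition.** Let $f=(f_1,f_2,f_3)=\alpha\circ g\in\operatorname{Aut}(\mathbb{A}^3)$, where $\alpha$ is an affine automorphism of $\mathbb{A}^3$ and $$g=(x+yz+z\,a(x,z)+\xi z,\; y+a(x,z)+r(z),\; z),$$ with $\xi\in k$, $a(x,z)=a_0x^2+a_1xz+a_2z^2+a_3x+a_4z$, $a_0,\dots,a_4\in k$, $(a_0,a_1)\neq(0,0)$,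 and $r\in k[z]$ of degree $\le 3$. If $\alpha^*(z)\in k[z]$, then $\lambda(f)=\deg_x(a)\in\{1,2\}$. If $\alpha^*(z)\notin k[z]$, then $f$ is algebraically stable (and then $\lambda(f)=3$), or $f$ is conjugate by an element of $\operatorname{Aut}(\mathbb{A}^3)$ to an affine-triangular automorphism of degree $\le 3$, or $f$ is conjugate by an affine automorphism to an automorphism of the same form (for possibly different parameters $\alpha,\xi,a,r$ satisfying the same assumptions), with the same dynamical degree, which satisfies one of the following: 1. $\deg(r)=3$, $\alpha^*(x)\in k[z]$ and the coefficient of $z^3$ in $f_3$ is zero; 2. $\deg(r)\le 2$, $\alpha^*(y)\in k[z]$ and $\alpha^*(z)\in k[y,z]$; 3. $\deg(r)\le 2$, $\alpha^*(y)\in k[z]$, $\alpha^*(x)\in k[y,z]$ and $a_2=0$; 4. $\deg(r)\le 2$, $\alpha^*(x)\in k[z]$, $\alpha^*(y)\in k[y,z]$, $a_1\neq 0$ and $a_2=0$. Moreover, the dynamical degree of any $f$ as above that satisfies one of these conditions is as follows: - Case 1: $\lambda(f)=1+\sqrt2$ if $a_1\neq0$, and $\lambda(f)=(1+\sqrt{13})/2$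 if $a_1=0$. - Case 2: $\lambda(f)=1+\sqrt3$ if $a_0\neq0$, and $\lambda(f)=1+\sqrt2$ if $a_0=0$. - Case 3: let $\varepsilon$ be the coefficient of $z^2$ in $f_1$. Then $\lambda(f)=1+\sqrt3$ if $a_1\neq0$ and $\varepsilon\neq0$; $\lambda(f)=(3+\sqrt5)/2$ if $a_1\neq0$ and $\varepsilon=0$; $\lambda(f)=(1+\sqrt{17})/2$ if $a_1=0$ and $\varepsilon\neq0$; $\lambda(f)=2$ if $a_1=0$ and $\varepsilon=0$. - Case 4: $\lambda(f)=1+\sqrt2$. -/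

import Mathlib

open Filter Topology

noncomputable section

namespace AffineSpace

/-- A polynomial endomorphism `(f_1, …, f_n)` of affine `n`-space over `k`, given by its components. -/
abbrev Endo (k : Type*) [Field k] (n : ℕ) : Type _ := Fin n → MvPolynomial (Fin n) k

variable {k : Type*} [Field k] {n : ℕ}

/-- The identity morphism `(x_1, …, x_n)`. -/
def idMap (k : Type*) [Field k] (n : ℕ) : Endo k n := fun i => MvPolynomial.X i

/-- The composition `f ∘ g` of morphisms: its components are `f_i(g_1, …, g_n)`. -/
def comp (f g : Endo k n) : Endo k n := fun i => MvPolynomial.bind₁ g (f i)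

/-- The iterate `f^r = f ∘ ⋯ ∘ f`. -/
def iter (f : Endo k n) : ℕ → Endo k n
  | 0 => idMap k n
  | r + 1 => comp f (iter f r)

/-- The degree of `f`, the maximum of the degrees of its components. -/
def degree (f : Endo k n) : ℕ := Finset.univ.sup fun i => (f i).totalDegree

/-- `g` is the inverse of `f`. -/
def IsInverse (f g : Endo k n) : Prop := comp f g = idMap k n ∧ comp g f = idMap k n

/-- `f ∈ Aut(𝔸ⁿ)`. -/
def IsAut (f : Endo k n) : Prop := ∃ g : Endo k n, IsInverse f g

/-- `f ∈ Aff(𝔸ⁿ)`: an automorphism all of whose components have degree `1`. -/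
def IsAffine (f : Endo k n) : Prop := IsAut f ∧ ∀ i, (f i).totalDegree = 1

/-- `f` is a triangular automorphism: `f_i ∈ k[x_i, …, x_n]` for each `i`. -/
def IsTriangular (f : Endo k n) : Prop :=
  IsAut f ∧ ∀ i, f i ∈ MvPolynomial.supported k (Set.Ici i)

/-- `f = α ∘ τ` with `α` affine and `τ` triangular. -/
def IsAffineTriangular (f : Endo k n) : Prop :=
  ∃ α τ : Endo k n, IsAffine α ∧ IsTriangular τ ∧ f = comp α τ

/-- `deg(f^r) = deg(f)^r` for all `r > 0`. -/
def IsAlgebraicallyStable (f : Endo k n) : Prop :=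
  ∀ r : ℕ, 0 < r → degree (iter f r) = degree f ^ r

/-- The dynamical degree `lim_{r → ∞} deg(f^r)^{1/r}` of `f` exists and is equal to `l`. -/
def HasDynamicalDegree (f : Endo k n) (l : ℝ) : Prop :=
  Tendsto (fun r : ℕ => (degree (iter f r) : ℝ) ^ (1 / (r : ℝ))) atTop (𝓝 l)

/-- `h = φ ∘ f ∘ φ⁻¹`, where `φ` is an automorphism. -/
def IsConjBy (φ f h : Endo k n) : Prop :=
  ∃ ψ : Endo k n, IsInverse φ ψ ∧ h = comp φ (comp f ψ)

/-- The parameters `α`, `ξ`, `a_0, …, a_4`, `r` of the automorphism `f = α ∘ g` of `𝔸³`, where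
`g = (x + yz + z a(x,z) + ξ z, y + a(x,z) + r(z), z)`.
The coordinates `x`, `y`, `z` have the indices `0`, `1`, `2`. -/
structure Params (k : Type*) [Field k] where
  α : Endo k 3
  ξ : k
  a : Fin 5 → k
  r : Polynomial k

namespace Params

open MvPolynomial

/-- `α` is affine, `deg(r) ≤ 3` and `(a_0, a_1) ≠ (0, 0)`. -/
def Admissible (P : Params k) : Prop :=
  IsAffine P.α ∧ P.r.natDegree ≤ 3 ∧ (P.a 0, P.a 1) ≠ (0, 0)

/-- `a(x,z) = a_0 x² + a_1 xz + a_2 z² + a_3 x + a_4 z`. -/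
def aPoly (P : Params k) : MvPolynomial (Fin 3) k :=
  C (P.a 0) * X 0 ^ 2 + C (P.a 1) * X 0 * X 2 + C (P.a 2) * X 2 ^ 2 + C (P.a 3) * X 0
    + C (P.a 4) * X 2

/-- `g = (x + yz + z a(x,z) + ξ z, y + a(x,z) + r(z), z)`. -/
def g (P : Params k) : Endo k 3 :=
  ![X 0 + X 1 * X 2 + X 2 * P.aPoly + C P.ξ * X 2,
    X 1 + P.aPoly + Polynomial.aeval (X 2) P.r,
    X 2]

/-- `f = α ∘ g`. -/
def f (P : Params k) : Endo k 3 := comp P.α P.g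

/-- `deg(r) = 3`, `α*(x) ∈ k[z]` and the coefficient of `z³` in `f_3` is zero. -/
def Case1 (P : Params k) : Prop :=
  P.r.natDegree = 3 ∧ P.α 0 ∈ supported k {2} ∧ (P.f 2).coeff (Finsupp.single 2 3) = 0

/-- `deg(r) ≤ 2`, `α*(y) ∈ k[z]` and `α*(z) ∈ k[y,z]`. -/
def Case2 (P : Params k) : Prop :=
  P.r.natDegree ≤ 2 ∧ P.α 1 ∈ supported k {2} ∧ P.α 2 ∈ supported k {1, 2}

/-- `deg(r) ≤ 2`, `α*(y) ∈ k[z]`, `α*(x) ∈ k[y,z]` and `a_2 = 0`. -/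
def Case3 (P : Params k) : Prop :=
  P.r.natDegree ≤ 2 ∧ P.α 1 ∈ supported k {2} ∧ P.α 0 ∈ supported k {1, 2} ∧ P.a 2 = 0

/-- `deg(r) ≤ 2`, `α*(x) ∈ k[z]`, `α*(y) ∈ k[y,z]`, `a_1 ≠ 0` and `a_2 = 0`. -/
def Case4 (P : Params k) : Prop :=
  P.r.natDegree ≤ 2 ∧ P.α 0 ∈ supported k {2} ∧ P.α 1 ∈ supported k {1, 2} ∧
    P.a 1 ≠ 0 ∧ P.a 2 = 0

/-- The coefficient `ε` of `z²` in `f_1`. -/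
def ε (P : Params k) : k := (P.f 0).coeff (Finsupp.single 2 2)

end Params

end AffineSpace

end

open Filter Topology

noncomputable section

namespace AffineSpace

open MvPolynomial

/-! ### Composition, conjugation and affine maps as matrices. -/

section

variable {k : Type*} [Field k] {n : ℕ}

/-! Let `A` be the linear part of `α`, with rows and columns numbered from 0. Each component of `f`
is a combination of eleven monomials, and the cubic part of component `i` is `z * q_i(x,z)` with
`q_i = A i 0 * (a_0 x² + a_1 x z + a_2 z²) + A i 1 * r_3 z²`. It does not involve `y`, so the
coefficients of degree `3 ^ m` of the first and third components of the `m`-th iterate obey a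
recursion of their own (`topCoeff_succ`). If `q_0` and `q_2` are independent, the two coefficients
stay non-proportional and never vanish, because a binary quadratic form splits over `k`. If `q_0 = b
* q_2` with `q_2 ≠ 0`, they become proportional and survive exactly when `q_2(b,1) ≠ 0`. In both
situations `f` is algebraically stable.

What remains is `q_2 = 0`, or `q_0 = b * q_2` with `q_2(b,1) = 0`. Conjugation by `(x - bz, y - sx -
tz, z)` preserves the form of `f` and moves `b` to `0`; suitable `s` and `t` clear entries of the
second row of `α`. This gives the four cases, apart from two degenerate configurations in which
moving an elementary factor of `g` across `α` makes the map affine-triangular.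

For the dynamical degrees, substitute `x_i t^{w_i}` and follow the `t`-degrees of the components. In
each of the four cases, suitable inequalities between these degrees persist under `f` and make one
monomial strictly dominant in each component that drives the growth. Two of the degrees then satisfy
a linear recurrence with a nonnegative 2×2 matrix, and its eigenvalue with positive eigenvector is
`λ(f)` (`hasDynamicalDegree_of_invariant`). If `α*(z) ∈ k[z]`, the third degree stays bounded and
direct estimates give growth `2 ^ m` or at most linear growth. -/

theorem aeval_comp {S : Type*} [CommRing S] [Algebra k S] (v : Fin n → S) (f g : Endo k n)
    (i : Fin n) :
    aeval v (comp f g i) = aeval (fun j => aeval v (g j)) (f i) := by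
  simp only [comp, bind₁, ← AlgHom.comp_apply, comp_aeval]

theorem comp_assoc (f g h : Endo k n) : comp (comp f g) h = comp f (comp g h) := by
  funext i
  exact aeval_comp h f g i

@[simp] theorem comp_idMap (f : Endo k n) : comp f (idMap k n) = f := by
  funext i; exact aeval_X_left_apply (f i)

@[simp] theorem idMap_comp (f : Endo k n) : comp (idMap k n) f = f := by
  funext i; simp [comp, idMap]

theorem IsInverse.symm {f g : Endo k n} (h : IsInverse f g) : IsInverse g f := ⟨h.2, h.1⟩

theorem isInverse_comp {f f' g g' : Endo k n} (hf : IsInverse f f') (hg : IsInverse g g') :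
    IsInverse (comp f g) (comp g' f') := by
  constructor
  · rw [comp_assoc, ← comp_assoc g, hg.1, idMap_comp, hf.1]
  · rw [comp_assoc, ← comp_assoc f', hf.2, idMap_comp, hg.2]

theorem isAut_comp {f g : Endo k n} (hf : IsAut f) (hg : IsAut g) :
    IsAut (comp f g) := by
  obtain ⟨f', hf⟩ := hf
  obtain ⟨g', hg⟩ := hg
  exact ⟨_, isInverse_comp hf hg⟩

theorem IsConjBy.trans {φ ψ f g h : Endo k n} (h₁ : IsConjBy φ f g) (h₂ : IsConjBy ψ g h) :
    IsConjBy (comp ψ φ) f h := by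
  obtain ⟨φ', hφ, rfl⟩ := h₁
  obtain ⟨ψ', hψ, rfl⟩ := h₂
  exact ⟨_, isInverse_comp hψ hφ, by simp only [comp_assoc]⟩

theorem iter_conj {φ ψ : Endo k n} (h : IsInverse φ ψ) (f : Endo k n) (m : ℕ) :
    iter (comp φ (comp f ψ)) m = comp φ (comp (iter f m) ψ) := by
  induction m with
  | zero => simp [iter, h.1]
  | succ m ih =>
    simp only [iter]
    rw [ih, comp_assoc, comp_assoc, ← comp_assoc ψ, h.2, idMap_comp, ← comp_assoc f]

theorem totalDegree_le_degree (f : Endo k n) (i : Fin n) : (f i).totalDegree ≤ degree f :=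
  Finset.le_sup (f := fun i => (f i).totalDegree) (Finset.mem_univ i)

theorem totalDegree_aeval_le (p : MvPolynomial (Fin n) k) (g : Endo k n) :
    (aeval g p).totalDegree ≤ p.totalDegree * degree g := by
  rw [aeval_def, eval₂_eq']
  refine (totalDegree_finsetSum _ _).trans (Finset.sup_le fun d hd => ?_)
  refine (totalDegree_mul _ _).trans ?_
  rw [MvPolynomial.algebraMap_eq, totalDegree_C, zero_add]
  refine (totalDegree_finsetProd _ _).trans ?_
  refine (Finset.sum_le_sum (g := fun i => d i * degree g) fun i _ => ?_).trans ?_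
  · exact (totalDegree_pow _ _).trans (Nat.mul_le_mul_left _ (totalDegree_le_degree g i))
  · rw [← Finset.sum_mul]
    refine Nat.mul_le_mul_right _ ?_
    have := le_totalDegree hd
    rwa [Finsupp.sum_fintype _ _ (fun _ => rfl)] at this

theorem degree_comp_le (f g : Endo k n) : degree (comp f g) ≤ degree f * degree g :=
  Finset.sup_le fun i _ => (totalDegree_aeval_le (f i) g).trans
    (Nat.mul_le_mul_right _ (totalDegree_le_degree f i))

/-- Maps of degree at most 1 cannot raise the degree under composition, and this applies to the
conjugation and to its inverse. Hence affine conjugation preserves the dynamical degree. -/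
theorem degree_iter_conj {φ ψ : Endo k n} (h : IsInverse φ ψ) (hφ : degree φ ≤ 1)
    (hψ : degree ψ ≤ 1) (f : Endo k n) (m : ℕ) :
    degree (iter (comp φ (comp f ψ)) m) = degree (iter f m) := by
  have key : ∀ {φ ψ : Endo k n}, degree φ ≤ 1 → degree ψ ≤ 1 → ∀ g : Endo k n,
      degree (comp φ (comp g ψ)) ≤ degree g := fun {φ ψ} hφ hψ g =>
    calc degree (comp φ (comp g ψ)) ≤ degree φ * (degree g * degree ψ) :=
          (degree_comp_le _ _).trans (Nat.mul_le_mul_left _ (degree_comp_le _ _))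
      _ ≤ 1 * (degree g * 1) := by gcongr
      _ = degree g := by ring
  rw [iter_conj h]
  refine le_antisymm (key hφ hψ _) ?_
  have := key hψ hφ (comp φ (comp (iter f m) ψ))
  rwa [comp_assoc, comp_assoc, h.2, comp_idMap, ← comp_assoc, h.2, idMap_comp] at this

theorem IsAut.totalDegree_ne_zero {f : Endo k n} (hf : IsAut f) (i : Fin n) :
    (f i).totalDegree ≠ 0 := by
  intro h0
  obtain ⟨g, hg, -⟩ := hf
  rw [totalDegree_eq_zero_iff_eq_C] at h0
  have := congrFun hg i
  rw [comp, h0, idMap, bind₁_C_right] at this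
  have h2 := congrArg totalDegree this
  rw [totalDegree_C, totalDegree_X] at h2
  exact zero_ne_one h2

theorem IsAut.isAffine {f : Endo k n} (hf : IsAut f) (h : ∀ i, (f i).totalDegree ≤ 1) :
    IsAffine f :=
  ⟨hf, fun i => le_antisymm (h i) (Nat.one_le_iff_ne_zero.2 (hf.totalDegree_ne_zero i))⟩

/-- The map `x ↦ A x + c`. -/
def affineMap (A : Matrix (Fin n) (Fin n) k) (c : Fin n → k) : Endo k n :=
  fun i => ∑ j, C (A i j) * X j + C (c i)

theorem eq_linear_of_totalDegree_le_one {p : MvPolynomial (Fin n) k} (h : p.totalDegree ≤ 1) :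
    p = ∑ j, C (p.coeff (Finsupp.single j 1)) * X j + C (p.coeff 0) := by
  classical
  ext d
  simp only [coeff_add, coeff_sum, coeff_C_mul, coeff_X, coeff_C]
  rcases lt_trichotomy d.degree 1 with h0 | h1 | h2
  · obtain rfl : d = 0 := (Finsupp.degree_eq_zero_iff d).1 (by omega)
    simp
  · obtain ⟨i, rfl⟩ : ∃ i, d = Finsupp.single i 1 := (Finsupp.sum_eq_one_iff d).1
      (by rw [← h1, Finsupp.degree_eq_sum, Finsupp.sum_fintype _ _ fun _ => rfl])
    rw [Finset.sum_eq_single i]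
    · simp [eq_comm (a := (0 : Fin n →₀ ℕ))]
    · intro j _ hj
      rw [if_neg, mul_zero]
      exact fun h => hj (Finsupp.single_left_injective one_ne_zero h)
    · simp
  · rw [coeff_eq_zero_of_totalDegree_lt, if_neg, add_zero, eq_comm]
    · refine Finset.sum_eq_zero fun j _ => ?_
      rw [if_neg, mul_zero]
      rintro rfl
      simp at h2
    · rintro rfl
      simp at h2
    · exact h.trans_lt h2

theorem totalDegree_affineMap_le (A : Matrix (Fin n) (Fin n) k) (c : Fin n → k) (i : Fin n) :
    (affineMap A c i).totalDegree ≤ 1 := by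
  refine (totalDegree_add _ _).trans (max_le ?_ (by simp))
  refine (totalDegree_finsetSum _ _).trans (Finset.sup_le fun j _ => ?_)
  refine (totalDegree_mul _ _).trans ?_
  simp

theorem det_ne_zero_of_isAut {A : Matrix (Fin n) (Fin n) k} {c : Fin n → k}
    (h : IsAut (affineMap A c)) : A.det ≠ 0 := by
  obtain ⟨g, hg, -⟩ := h
  have hs : Function.Surjective A.mulVec := by
    intro b
    -- The preimage of `b` under `A` is the preimage of `b + c` under `x ↦ A x + c`, which the
    -- inverse `g` supplies.
    refine ⟨fun j => aeval (fun i => b i + c i) (g j), ?_⟩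
    funext i
    have h1 := aeval_comp (fun i => b i + c i) (affineMap A c) g i
    rw [hg] at h1
    simp only [idMap, affineMap, aeval_X, map_add, map_sum, map_mul, aeval_C,
      Algebra.algebraMap_self, RingHom.id_apply] at h1
    exact (add_right_cancel h1).symm
  have : IsUnit A := Matrix.mulVec_surjective_iff_isUnit.1 hs
  exact ((Matrix.isUnit_iff_isUnit_det A).1 this).ne_zero

theorem IsAffine.exists_eq_affineMap {f : Endo k n} (hf : IsAffine f) :
    ∃ (A : Matrix (Fin n) (Fin n) k) (c : Fin n → k), f = affineMap A c ∧ A.det ≠ 0 := by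
  have h : f = affineMap (fun i j => (f i).coeff (Finsupp.single j 1)) fun i => (f i).coeff 0 :=
    funext fun i => eq_linear_of_totalDegree_le_one (hf.2 i).le
  exact ⟨_, _, h, det_ne_zero_of_isAut (h ▸ hf.1)⟩

theorem affineMap_mem_supported_iff (A : Matrix (Fin n) (Fin n) k) (c : Fin n → k) (i : Fin n)
    (s : Set (Fin n)) : affineMap A c i ∈ supported k s ↔ ∀ j, j ∉ s → A i j = 0 := by
  classical
  constructor
  · intro h j hj
    rw [mem_supported] at h
    by_contra hA
    refine hj (h ?_)
    rw [Finset.mem_coe, mem_vars_iff_mem_support]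
    refine ⟨Finsupp.single j 1, ?_, by simp⟩
    rw [mem_support_iff, affineMap]
    simpa [coeff_add, coeff_sum, coeff_C_mul, coeff_X, coeff_C, eq_comm,
      Finsupp.single_left_inj] using hA
  · intro h
    refine add_mem (sum_mem fun j _ => ?_) (algebraMap_mem _ (c i))
    by_cases hj : j ∈ s
    · exact mul_mem (algebraMap_mem _ (A i j)) (X_mem_supported.2 hj)
    · simp [h j hj]

end

/-! ### Weighted degrees along an orbit, and growth rates. -/

section

variable {k : Type*} [Field k] {n : ℕ}

/-- The orbit of the point `v` under `f`. -/
def orbit {S : Type*} [CommRing S] [Algebra k S] (f : Endo k n) (v : Fin n → S) (m : ℕ) :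
    Fin n → S :=
  fun i => aeval v (iter f m i)

@[simp] theorem orbit_zero {S : Type*} [CommRing S] [Algebra k S] (f : Endo k n)
    (v : Fin n → S) : orbit f v 0 = v := by
  funext i; simp [orbit, iter, idMap]

theorem orbit_succ {S : Type*} [CommRing S] [Algebra k S] (f : Endo k n)
    (v : Fin n → S) (m : ℕ) (i : Fin n) :
    orbit f v (m + 1) i = aeval (orbit f v m) (f i) :=
  aeval_comp v f (iter f m) i

variable (k) in
/-- The point `(x_i t^{w_i})_i`. -/
def weightPoint (w : Fin n → ℕ) : Fin n → Polynomial (MvPolynomial (Fin n) k) :=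
  fun i => Polynomial.monomial (w i) (X i)

theorem aeval_weightPoint_monomial (w : Fin n → ℕ) (d : Fin n →₀ ℕ) (c : k) :
    aeval (weightPoint k w) (monomial d c) =
      Polynomial.monomial (∑ i, d i * w i) (monomial d c) := by
  have h : ∀ s : Finset (Fin n), ∏ i ∈ s, weightPoint k w i ^ d i =
      Polynomial.monomial (∑ i ∈ s, d i * w i) (∏ i ∈ s, X i ^ d i) := by
    intro s
    induction s using Finset.cons_induction with
    | empty => simp
    | cons a s ha ih =>
      rw [Finset.prod_cons, ih, Finset.sum_cons, Finset.prod_cons, weightPoint,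
        Polynomial.monomial_pow, Polynomial.monomial_mul_monomial, mul_comm (d a)]
  rw [aeval_monomial, Finsupp.prod_fintype _ _ (fun _ => pow_zero _), h,
    Polynomial.algebraMap_apply, Polynomial.C_mul_monomial,
    MvPolynomial.algebraMap_eq, monomial_eq (s := d), Finsupp.prod_fintype _ _ (fun _ => pow_zero _)]

/-- The coefficients in `t` still carry the variables, so distinct monomials of equal weight cannot
cancel. The `t`-degree is therefore a true weighted degree. -/
theorem coeff_aeval_weightPoint (w : Fin n → ℕ) (p : MvPolynomial (Fin n) k) (d : Fin n →₀ ℕ) :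
    ((aeval (weightPoint k w) p).coeff (∑ i, d i * w i)).coeff d = p.coeff d := by
  induction p using MvPolynomial.induction_on' with
  | monomial e c =>
    rw [aeval_weightPoint_monomial, Polynomial.coeff_monomial]
    split_ifs with h
    · rfl
    · rw [coeff_zero, coeff_monomial, if_neg]
      rintro rfl
      exact h rfl
  | add p q hp hq => simp only [map_add, Polynomial.coeff_add, coeff_add, hp, hq]

theorem totalDegree_le_natDegree_aeval_weightPoint {w : Fin n → ℕ} (hw : ∀ i, 1 ≤ w i)
    (p : MvPolynomial (Fin n) k) :
    p.totalDegree ≤ (aeval (weightPoint k w) p).natDegree := by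
  refine Finset.sup_le fun d hd => ?_
  rw [Finsupp.sum_fintype _ _ (fun _ => rfl)]
  calc ∑ i, d i ≤ ∑ i, d i * w i := Finset.sum_le_sum fun i _ => Nat.le_mul_of_pos_right _ (hw i)
    _ ≤ _ := by
      refine Polynomial.le_natDegree_of_ne_zero fun h => ?_
      have := coeff_aeval_weightPoint w p d
      rw [h, coeff_zero] at this
      exact (mem_support_iff.1 hd) this.symm

theorem natDegree_aeval_weightPoint_le {w : Fin n → ℕ} {W : ℕ} (hw : ∀ i, w i ≤ W)
    (p : MvPolynomial (Fin n) k) :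
    (aeval (weightPoint k w) p).natDegree ≤ W * p.totalDegree := by
  conv_lhs => rw [p.as_sum, map_sum]
  refine Polynomial.natDegree_sum_le_of_forall_le _ _ fun d hd => ?_
  rw [aeval_weightPoint_monomial]
  refine (Polynomial.natDegree_monomial_le _).trans ?_
  have h := le_totalDegree hd
  rw [Finsupp.sum_fintype _ _ (fun _ => rfl)] at h
  calc ∑ i, d i * w i ≤ ∑ i, d i * W := Finset.sum_le_sum fun i _ => Nat.mul_le_mul_left _ (hw i)
    _ = W * ∑ i, d i := by rw [← Finset.sum_mul, mul_comm]
    _ ≤ _ := Nat.mul_le_mul_left _ h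

theorem degree_iter_le {f : Endo k n} {w : Fin n → ℕ} (hw : ∀ i, 1 ≤ w i) {m N : ℕ}
    (h : ∀ i, (orbit f (weightPoint k w) m i).natDegree ≤ N) : degree (iter f m) ≤ N :=
  Finset.sup_le fun i _ => (totalDegree_le_natDegree_aeval_weightPoint hw _).trans (h i)

theorem natDegree_orbit_le (f : Endo k n) {w : Fin n → ℕ} {W : ℕ} (hw : ∀ i, w i ≤ W) (m : ℕ)
    (i : Fin n) : (orbit f (weightPoint k w) m i).natDegree ≤ W * degree (iter f m) :=
  (natDegree_aeval_weightPoint_le hw _).trans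
    (Nat.mul_le_mul_left _ (totalDegree_le_degree _ i))

theorem tendsto_const_rpow_one_div {c : ℝ} (hc : 0 < c) :
    Tendsto (fun m : ℕ => c ^ (1 / (m : ℝ))) atTop (𝓝 1) := by
  have h := (Real.continuousAt_const_rpow hc.ne' (b := 0)).tendsto.comp
    (tendsto_one_div_atTop_nhds_zero_nat (𝕜 := ℝ))
  rwa [Real.rpow_zero] at h

theorem tendsto_rpow_one_div_of_bounds {d : ℕ → ℝ} {θ c C : ℝ} (hθ : 0 < θ) (hc : 0 < c)
    (hC : 0 < C) (hl : ∀ m, c * θ ^ m ≤ d m) (hu : ∀ m, d m ≤ C * θ ^ m) :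
    Tendsto (fun m : ℕ => d m ^ (1 / (m : ℝ))) atTop (𝓝 θ) := by
  have key : ∀ {b : ℝ}, 0 < b →
      Tendsto (fun m : ℕ => (b * θ ^ m) ^ (1 / (m : ℝ))) atTop (𝓝 θ) := by
    intro b hb
    have h := (tendsto_const_rpow_one_div hb).mul_const θ
    rw [one_mul] at h
    refine h.congr' ?_
    filter_upwards [eventually_ge_atTop 1] with m hm
    rw [Real.mul_rpow hb.le (by positivity), one_div, Real.pow_rpow_inv_natCast hθ.le (by omega)]
  refine tendsto_of_tendsto_of_tendsto_of_le_of_le (key hc) (key hC) (fun m => ?_) fun m => ?_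
  · exact Real.rpow_le_rpow (by positivity) (hl m) (by positivity)
  · exact Real.rpow_le_rpow ((by positivity : 0 ≤ c * θ ^ m).trans (hl m)) (hu m) (by positivity)

/-- Weighted and ordinary degrees differ by at most the factor `max w`, which disappears under
`m`-th roots. The weights may thus be chosen freely to start a recurrence in a convenient region. -/
theorem hasDynamicalDegree_of_bounds {f : Endo k n} {w : Fin n → ℕ} (hw : ∀ i, 1 ≤ w i)
    {θ c C : ℝ} (hθ : 0 < θ) (hc : 0 < c) (hC : 0 < C) (i : Fin n)
    (hl : ∀ m, c * θ ^ m ≤ (orbit f (weightPoint k w) m i).natDegree)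
    (hu : ∀ m j, ((orbit f (weightPoint k w) m j).natDegree : ℝ) ≤ C * θ ^ m) :
    HasDynamicalDegree f θ := by
  have hW : ∀ j, w j ≤ Finset.univ.sup w := fun j => Finset.le_sup (Finset.mem_univ j)
  set W := Finset.univ.sup w
  have hW0 : 0 < W := (hw i).trans (hW i)
  have hW1 : (0 : ℝ) < W := by exact_mod_cast hW0
  refine tendsto_rpow_one_div_of_bounds (c := c / W) hθ (by positivity) hC (fun m => ?_)
    fun m => ?_
  · rw [div_mul_eq_mul_div, div_le_iff₀ hW1]
    refine (hl m).trans ?_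
    rw [mul_comm]
    exact_mod_cast natDegree_orbit_le f hW m i
  · have h : degree (iter f m) ≤ ⌊C * θ ^ m⌋₊ :=
      degree_iter_le hw fun j => Nat.le_floor (hu m j)
    exact (Nat.le_floor_iff (by positivity)).1 h

/-- If the pair `(u, v)` is multiplied by a nonnegative matrix with positive eigenvector `(a, b)`
for the eigenvalue `θ`, then it grows like `θ ^ m`. -/
theorem linear_recurrence_bounds {u v : ℕ → ℝ} {p q r s a b θ : ℝ} (hp : 0 ≤ p) (hq : 0 ≤ q)
    (hr : 0 ≤ r) (hs : 0 ≤ s) (ha : 0 < a) (hb : 0 < b) (hθ : 0 < θ)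
    (h1 : p * a + q * b = θ * a) (h2 : r * a + s * b = θ * b)
    (hu0 : 0 < u 0) (hv0 : 0 < v 0)
    (hu : ∀ m, u (m + 1) = p * u m + q * v m) (hv : ∀ m, v (m + 1) = r * u m + s * v m) :
    ∃ c C : ℝ, 0 < c ∧ 0 < C ∧
      ∀ m, c * θ ^ m ≤ u m ∧ u m ≤ C * θ ^ m ∧ c * θ ^ m ≤ v m ∧ v m ≤ C * θ ^ m := by
  obtain ⟨c, hc, hca, hcb⟩ : ∃ c : ℝ, 0 < c ∧ c * a ≤ u 0 ∧ c * b ≤ v 0 := by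
    refine ⟨min (u 0 / a) (v 0 / b), by positivity, ?_, ?_⟩
    · exact (le_div_iff₀ ha).1 (min_le_left _ _)
    · exact (le_div_iff₀ hb).1 (min_le_right _ _)
  obtain ⟨C, hC, hCa, hCb⟩ : ∃ C : ℝ, 0 < C ∧ u 0 ≤ C * a ∧ v 0 ≤ C * b := by
    refine ⟨max (u 0 / a) (v 0 / b), by positivity, ?_, ?_⟩
    · exact (div_le_iff₀ ha).1 (le_max_left _ _)
    · exact (div_le_iff₀ hb).1 (le_max_right _ _)
  -- A nonnegative matrix preserves componentwise inequalities, so `(u, v)` stays between two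
  -- multiples of the eigenvector.
  have key : ∀ m, c * a * θ ^ m ≤ u m ∧ u m ≤ C * a * θ ^ m ∧
      c * b * θ ^ m ≤ v m ∧ v m ≤ C * b * θ ^ m := by
    intro m
    induction m with
    | zero => simp [*]
    | succ m ih =>
      obtain ⟨i1, i2, i3, i4⟩ := ih
      have e1 : ∀ c : ℝ, c * a * θ ^ (m + 1) = p * (c * a * θ ^ m) + q * (c * b * θ ^ m) :=
        fun c => by linear_combination (-c * θ ^ m) * h1
      have e2 : ∀ c : ℝ, c * b * θ ^ (m + 1) = r * (c * a * θ ^ m) + s * (c * b * θ ^ m) :=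
        fun c => by linear_combination (-c * θ ^ m) * h2
      rw [hu, hv, e1, e1, e2, e2]
      refine ⟨?_, ?_, ?_, ?_⟩ <;> gcongr
  refine ⟨c * min a b, C * max a b, by positivity, by positivity, fun m => ?_⟩
  obtain ⟨i1, i2, i3, i4⟩ := key m
  refine ⟨le_trans ?_ i1, i2.trans ?_, le_trans ?_ i3, i4.trans ?_⟩
  · gcongr; exact min_le_left _ _
  · gcongr; exact le_max_left _ _
  · gcongr; exact min_le_right _ _
  · gcongr; exact le_max_right _ _

theorem hasDynamicalDegree_of_linear_recurrence {f : Endo k n} {w : Fin n → ℕ}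
    (hw : ∀ i, 1 ≤ w i) (i j : Fin n) {p q r s : ℕ} {θ a b : ℝ} (ha : 0 < a) (hb : 0 < b)
    (hθ : 0 < θ) (h1 : p * a + q * b = θ * a) (h2 : r * a + s * b = θ * b)
    {d : ℕ → Fin n → ℕ} (hd : ∀ m l, d m l = (orbit f (weightPoint k w) m l).natDegree)
    (hi : ∀ m, d (m + 1) i = p * d m i + q * d m j)
    (hj : ∀ m, d (m + 1) j = r * d m i + s * d m j)
    (hle : ∀ m l, d m l ≤ 2 * d m i + 2 * d m j) : HasDynamicalDegree f θ := by
  have h0 : ∀ l, 0 < d 0 l := by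
    intro l
    rw [hd, orbit_zero, weightPoint, Polynomial.natDegree_monomial_eq _ (X_ne_zero l)]
    exact hw l
  obtain ⟨c, C, hc, hC, h⟩ := linear_recurrence_bounds (u := fun m => (d m i : ℝ))
    (v := fun m => (d m j : ℝ)) (Nat.cast_nonneg p) (Nat.cast_nonneg q) (Nat.cast_nonneg r)
    (Nat.cast_nonneg s) ha hb hθ h1 h2 (by exact_mod_cast h0 i) (by exact_mod_cast h0 j)
    (fun m => by rw [hi]; push_cast; rfl) (fun m => by rw [hj]; push_cast; rfl)
  refine hasDynamicalDegree_of_bounds hw hθ hc (C := 4 * C) (by positivity) i (fun m => ?_)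
    fun m l => ?_
  · rw [← hd]; exact (h m).1
  · rw [← hd]
    have h3 : (d m l : ℝ) ≤ 2 * d m i + 2 * d m j := by exact_mod_cast hle m l
    have h4 := (h m).2.1
    have h5 := (h m).2.2.2
    linarith

end

/-! ### The components of `f` as combinations of eleven monomials. -/

section

variable {k : Type*} [Field k]

section Cubic

variable {S : Type*} [CommRing S] [Algebra k S]

/-- The monomials occurring in `g`. -/
def cubicMonomial (v : Fin 3 → S) : Fin 11 → S :=
  ![1, v 0, v 1, v 2, v 1 * v 2, v 0 ^ 2 * v 2, v 0 * v 2 ^ 2, v 2 ^ 3, v 0 * v 2, v 2 ^ 2, v 0 ^ 2]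

/-- The degrees of the entries of `cubicMonomial`. -/
def cubicDegree (d : Fin 3 → ℕ) : Fin 11 → ℕ :=
  ![0, d 0, d 1, d 2, d 1 + d 2, 2 * d 0 + d 2, d 0 + 2 * d 2, 3 * d 2, d 0 + d 2, 2 * d 2, 2 * d 0]

/-- The linear combination of the entries of `cubicMonomial` with coefficients `e`. -/
def cubic (e : Fin 11 → k) (v : Fin 3 → S) : S := ∑ j, algebraMap k S (e j) * cubicMonomial v j

namespace Params

/-- The coefficients of `b_0 g_1 + b_1 g_2 + b_2 g_3 + c`. -/
def cubicCoeff (P : Params k) (b : Fin 3 → k) (c : k) : Fin 11 → k :=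
  ![c + b 1 * P.r.coeff 0, b 0 + b 1 * P.a 3, b 1,
    b 0 * P.ξ + b 1 * (P.a 4 + P.r.coeff 1) + b 2, b 0, b 0 * P.a 0, b 0 * P.a 1,
    b 0 * P.a 2 + b 1 * P.r.coeff 3, b 0 * P.a 3 + b 1 * P.a 1,
    b 0 * P.a 4 + b 1 * (P.a 2 + P.r.coeff 2), b 1 * P.a 0]

theorem aeval_r (P : Params k) (h : P.r.natDegree ≤ 3) (z : S) :
    Polynomial.aeval z P.r = algebraMap k S (P.r.coeff 0) + algebraMap k S (P.r.coeff 1) * z +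
      algebraMap k S (P.r.coeff 2) * z ^ 2 + algebraMap k S (P.r.coeff 3) * z ^ 3 := by
  rw [Polynomial.aeval_eq_sum_range' (n := 4) (by omega)]
  simp [Finset.sum_range_succ, Algebra.smul_def]

theorem aeval_f (P : Params k) (h : P.r.natDegree ≤ 3) {A : Matrix (Fin 3) (Fin 3) k}
    {c : Fin 3 → k} (hα : P.α = affineMap A c) (i : Fin 3) (v : Fin 3 → S) :
    aeval v (P.f i) = cubic (P.cubicCoeff (A i) (c i)) v := by
  rw [f, aeval_comp, hα]
  simp only [affineMap, cubic, map_add, map_mul, aeval_X, aeval_C, g, aPoly, Fin.sum_univ_succ,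
    cubicCoeff, cubicMonomial, Matrix.cons_val_zero, map_pow, P.aeval_r h]
  simp
  ring

end Params

end Cubic

section Degree

variable {K : Type*} [CommRing K] [IsDomain K] [Algebra k K]

theorem natDegree_cubicMonomial_le (v : Fin 3 → Polynomial K) (j : Fin 11) :
    (cubicMonomial v j).natDegree ≤ cubicDegree (fun i => (v i).natDegree) j := by
  fin_cases j <;> simp [cubicMonomial, cubicDegree]
  all_goals refine Polynomial.natDegree_mul_le.trans ?_
  all_goals simp

theorem natDegree_cubicMonomial {v : Fin 3 → Polynomial K} {j : Fin 11}
    (h : cubicMonomial v j ≠ 0) :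
    (cubicMonomial v j).natDegree = cubicDegree (fun i => (v i).natDegree) j := by
  fin_cases j <;> simp [cubicMonomial, cubicDegree] at h ⊢
  all_goals rw [Polynomial.natDegree_mul (by simp [h]) (by simp [h])]
  all_goals simp

theorem natDegree_cubic_le {e : Fin 11 → k} {v : Fin 3 → Polynomial K} {N : ℕ}
    (h : ∀ j, e j ≠ 0 → cubicDegree (fun i => (v i).natDegree) j ≤ N) :
    (cubic e v).natDegree ≤ N := by
  refine Polynomial.natDegree_sum_le_of_forall_le _ _ fun j _ => ?_
  by_cases hj : e j = 0
  · simp [hj]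
  · rw [Polynomial.algebraMap_apply]
    exact (Polynomial.natDegree_C_mul_le _ _).trans ((natDegree_cubicMonomial_le v j).trans (h j hj))

/-- Strict dominance of one monomial rules out cancellation of the top term. -/
theorem natDegree_cubic {e : Fin 11 → k} {v : Fin 3 → Polynomial K} (j : Fin 11)
    (hj : e j ≠ 0) (hv : cubicMonomial v j ≠ 0)
    (h : ∀ l, l ≠ j → e l ≠ 0 → cubicDegree (fun i => (v i).natDegree) l <
      cubicDegree (fun i => (v i).natDegree) j) :
    cubic e v ≠ 0 ∧ (cubic e v).natDegree = cubicDegree (fun i => (v i).natDegree) j := by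
  classical
  set N := cubicDegree (fun i => (v i).natDegree) j with hN
  have hj' : algebraMap k K (e j) ≠ 0 := by simpa using hj
  have hlead : (algebraMap k (Polynomial K) (e j) * cubicMonomial v j).degree = (N : WithBot ℕ) := by
    rw [Polynomial.algebraMap_apply, Polynomial.degree_mul, Polynomial.degree_C hj', zero_add,
      Polynomial.degree_eq_natDegree hv, natDegree_cubicMonomial hv]
  have hrest : (∑ l ∈ Finset.univ.erase j,
      algebraMap k (Polynomial K) (e l) * cubicMonomial v l).degree < (N : WithBot ℕ) := by
    rw [← Polynomial.mem_degreeLT]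
    refine Submodule.sum_mem _ fun l hl => ?_
    rw [Polynomial.mem_degreeLT]
    by_cases hl0 : e l = 0
    · simp [hl0]
    · rw [Polynomial.algebraMap_apply]
      refine lt_of_le_of_lt Polynomial.degree_le_natDegree ?_
      exact_mod_cast ((Polynomial.natDegree_C_mul_le _ _).trans
        (natDegree_cubicMonomial_le v l)).trans_lt (h l (Finset.ne_of_mem_erase hl) hl0)
  have hdeg : (cubic e v).degree = (N : WithBot ℕ) := by
    rw [cubic, ← Finset.add_sum_erase _ _ (Finset.mem_univ j),
      Polynomial.degree_add_eq_left_of_degree_lt (hrest.trans_eq hlead.symm), hlead]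
  refine ⟨?_, Polynomial.natDegree_eq_of_degree_eq_some hdeg⟩
  intro h0
  simp [h0] at hdeg

end Degree

theorem det_fin_three_ne_zero {A : Matrix (Fin 3) (Fin 3) k} (hA : A.det ≠ 0) :
    A 0 0 * A 1 1 * A 2 2 - A 0 0 * A 1 2 * A 2 1 - A 0 1 * A 1 0 * A 2 2 + A 0 1 * A 1 2 * A 2 0 +
      A 0 2 * A 1 0 * A 2 1 - A 0 2 * A 1 1 * A 2 0 ≠ 0 := by
  rwa [← Matrix.det_fin_three]

namespace Params

theorem orbit_succ_eq {P : Params k} (hr : P.r.natDegree ≤ 3) {A : Matrix (Fin 3) (Fin 3) k}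
    {c : Fin 3 → k} (hα : P.α = affineMap A c) (w : Fin 3 → ℕ) (m : ℕ) (i : Fin 3) :
    orbit P.f (weightPoint k w) (m + 1) i =
      cubic (P.cubicCoeff (A i) (c i)) (orbit P.f (weightPoint k w) m) := by
  rw [orbit_succ, P.aeval_f hr hα]

end Params

end

/-! ### Degree recurrences, and the dynamical degree in Case 1. -/

section

variable {k : Type*} [Field k]

namespace Params

/-- `d'` are the degrees of the components of `f(v)` for some `v` with degrees `d`, where `A` and
`c` are the coefficients of `α`. -/
def DegreeStep (P : Params k) (A : Matrix (Fin 3) (Fin 3) k) (c : Fin 3 → k) (d d' : Fin 3 → ℕ) :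
    Prop :=
  ∃ v : Fin 3 → Polynomial (MvPolynomial (Fin 3) k), (∀ i, d i = (v i).natDegree) ∧
    ∀ i, d' i = (cubic (P.cubicCoeff (A i) (c i)) v).natDegree

/-- A monomial that strictly dominates the others determines the next degree. -/
theorem DegreeStep.eq {P : Params k} {A : Matrix (Fin 3) (Fin 3) k} {c : Fin 3 → k}
    {d d' : Fin 3 → ℕ} (h : P.DegreeStep A c d d') (i : Fin 3) (j : Fin 11) (h0 : 0 < d 0)
    (h2 : 0 < d 2) (h1 : (j ≠ 2 ∧ j ≠ 4) ∨ 0 < d 1) (hj : P.cubicCoeff (A i) (c i) j ≠ 0)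
    (hlt : ∀ l, l ≠ j → P.cubicCoeff (A i) (c i) l ≠ 0 → cubicDegree d l < cubicDegree d j) :
    d' i = cubicDegree d j := by
  obtain ⟨v, hv, hv'⟩ := h
  obtain rfl : d = fun i => (v i).natDegree := funext hv
  have hpos : ∀ l, 0 < (v l).natDegree → v l ≠ 0 := fun l hl h => by simp [h] at hl
  have := hpos 0 h0
  have := hpos 2 h2
  rw [hv']
  refine (natDegree_cubic j hj ?_ hlt).2
  -- Positive degree ensures that a coordinate is nonzero. Only the monomials `y` and `yz`, with
  -- indices 2 and 4, need this for the second coordinate.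
  rcases h1 with h1 | h1
  · fin_cases j <;> simp_all [cubicMonomial]
  · have := hpos 1 h1
    fin_cases j <;> simp_all [cubicMonomial]

theorem DegreeStep.le {P : Params k} {A : Matrix (Fin 3) (Fin 3) k} {c : Fin 3 → k}
    {d d' : Fin 3 → ℕ} (h : P.DegreeStep A c d d') (i : Fin 3) (N : ℕ)
    (hle : ∀ l, P.cubicCoeff (A i) (c i) l ≠ 0 → cubicDegree d l ≤ N) : d' i ≤ N := by
  obtain ⟨v, hv, hv'⟩ := h
  obtain rfl : d = fun i => (v i).natDegree := funext hv
  rw [hv']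
  exact natDegree_cubic_le hle

theorem natDegree_orbit_zero (P : Params k) (w : Fin 3 → ℕ) :
    (fun i => (orbit P.f (weightPoint k w) 0 i).natDegree) = w := by
  funext i
  rw [orbit_zero, weightPoint, Polynomial.natDegree_monomial_eq _ (X_ne_zero i)]

theorem degreeStep_orbit {P : Params k} (hr : P.r.natDegree ≤ 3) {A : Matrix (Fin 3) (Fin 3) k}
    {c : Fin 3 → k} (hα : P.α = affineMap A c) (w : Fin 3 → ℕ) (m : ℕ) :
    P.DegreeStep A c (fun i => (orbit P.f (weightPoint k w) m i).natDegree)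
      fun i => (orbit P.f (weightPoint k w) (m + 1) i).natDegree :=
  ⟨_, fun _ => rfl, fun i => congrArg _ (P.orbit_succ_eq hr hα w m i)⟩

theorem invariant_orbit {P : Params k} (hr : P.r.natDegree ≤ 3) {A : Matrix (Fin 3) (Fin 3) k}
    {c : Fin 3 → k} (hα : P.α = affineMap A c) {w : Fin 3 → ℕ} {I : ℕ → (Fin 3 → ℕ) → Prop}
    (hI0 : I 0 w) (hI : ∀ m d d', P.DegreeStep A c d d' → I m d → I (m + 1) d') (m : ℕ) :
    I m fun i => (orbit P.f (weightPoint k w) m i).natDegree := by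
  induction m with
  | zero => rwa [natDegree_orbit_zero]
  | succ m ih => exact hI m _ _ (degreeStep_orbit hr hα w m) ih

/-- The region `I` of degree vectors is where the dominant monomials are known. Once `f` preserves
it, the recurrence for coordinates `i` and `j` holds at every step, and the third degree only has to
be controlled by these two. -/
theorem hasDynamicalDegree_of_invariant {P : Params k} (hr : P.r.natDegree ≤ 3)
    {A : Matrix (Fin 3) (Fin 3) k} {c : Fin 3 → k} (hα : P.α = affineMap A c) (w : Fin 3 → ℕ)
    (hw : ∀ i, 1 ≤ w i) (I : (Fin 3 → ℕ) → Prop) (i j : Fin 3) (p q r s : ℕ) (a b : ℝ) {θ : ℝ}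
    (ha : 0 < a) (hb : 0 < b) (hθ : 0 < θ) (h1 : p * a + q * b = θ * a)
    (h2 : r * a + s * b = θ * b) (hI0 : I w)
    (hI : ∀ d d', P.DegreeStep A c d d' → I d →
      I d' ∧ d' i = p * d i + q * d j ∧ d' j = r * d i + s * d j)
    (hle : ∀ d, I d → ∀ l, d l ≤ 2 * d i + 2 * d j) : HasDynamicalDegree P.f θ := by
  have hinv := invariant_orbit hr hα (I := fun _ => I) hI0 (fun m d d' h hd => (hI d d' h hd).1)
  have hstep := fun m => (hI _ _ (degreeStep_orbit hr hα w m) (hinv m)).2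
  exact hasDynamicalDegree_of_linear_recurrence hw i j ha hb hθ h1 h2 (fun _ _ => rfl)
    (fun m => (hstep m).1) (fun m => (hstep m).2) (fun m => hle _ (hinv m))

/-- The dominant monomials are `z` in `f_1` and `z³` in `f_2`; in `f_3`, where `z³` is absent, it is
`xz²` if `a_1 ≠ 0`. If `a_1 = 0`, then `yz` wins over `x²z` because the degree of `y` stays above
twice that of `x`. The characteristic polynomials are `λ² - 2λ - 1` and `λ² - λ - 3`. -/
theorem hasDynamicalDegree_case1 {P : Params k} (hr : P.r.natDegree ≤ 3)
    (hr3 : P.r.coeff 3 ≠ 0) (ha : P.a 0 ≠ 0 ∨ P.a 1 ≠ 0) {A : Matrix (Fin 3) (Fin 3) k}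
    {c : Fin 3 → k} (hα : P.α = affineMap A c) (hA : A.det ≠ 0) (h00 : A 0 0 = 0) (h01 : A 0 1 = 0)
    (h7 : A 2 0 * P.a 2 + A 2 1 * P.r.coeff 3 = 0) :
    (P.a 1 ≠ 0 → HasDynamicalDegree P.f (1 + √2)) ∧
      (P.a 1 = 0 → HasDynamicalDegree P.f ((1 + √13) / 2)) := by
  have hdet := det_fin_three_ne_zero hA
  have h02 : A 0 2 ≠ 0 := fun h => hdet (by rw [h00, h01, h]; ring)
  have hmin : A 1 0 * A 2 1 - A 1 1 * A 2 0 ≠ 0 := fun h =>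
    hdet (by rw [h00, h01]; linear_combination A 0 2 * h)
  -- The vector `(a_2, r_3)` is nonzero, so it cannot be annihilated by two independent rows; hence
  -- `z³` does occur in `f_2`.
  have h17 : A 1 0 * P.a 2 + A 1 1 * P.r.coeff 3 ≠ 0 := fun h => by
    have : P.r.coeff 3 * (A 1 0 * A 2 1 - A 1 1 * A 2 0) = 0 := by
      linear_combination A 1 0 * h7 - A 2 0 * h
    exact (mul_ne_zero hr3 hmin) this
  have h20 : A 2 0 ≠ 0 := fun h => by
    rw [h, zero_mul, zero_add] at h7
    rcases mul_eq_zero.1 h7 with h' | h'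
    · exact hmin (by rw [h, h']; ring)
    · exact hr3 h'
  have s2 : (√2) ^ 2 = 2 := Real.sq_sqrt (by norm_num)
  have s13 : (√13) ^ 2 = 13 := Real.sq_sqrt (by norm_num)
  constructor
  · intro ha1
    refine hasDynamicalDegree_of_invariant hr hα ![1, 1, 2] (by decide)
      (fun d => 0 < d 0 ∧ d 0 < d 2 ∧ d 1 < d 0 + d 2) 0 2 0 1 1 2 1 (1 + √2) one_pos
      (by positivity) (by positivity) (by push_cast; ring) (by push_cast; linear_combination -s2)
      (by decide) ?_ ?_
    · rintro d d' hs ⟨i1, i2, i3⟩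
      have e0 := hs.eq 0 3 (by omega) (by omega) (.inl (by decide)) (by simp [cubicCoeff, *])
        (by intro l hl he
            fin_cases l <;> simp [cubicCoeff, cubicDegree, *] at hl he ⊢
            omega)
      have e1 := hs.eq 1 7 (by omega) (by omega) (.inl (by decide)) (by simp [cubicCoeff, *])
        (by intro l hl he
            fin_cases l <;> simp [cubicCoeff, cubicDegree, *] at hl he ⊢ <;> omega)
      have e2 := hs.eq 2 6 (by omega) (by omega) (.inl (by decide)) (by simp [cubicCoeff, *])
        (by intro l hl he
            fin_cases l <;> simp [cubicCoeff, cubicDegree, *] at hl he ⊢ <;> omega)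
      simp [cubicDegree] at e0 e1 e2
      omega
    · rintro d ⟨i1, i2, i3⟩ l
      fin_cases l <;> simp <;> omega
  · intro ha1
    have ha0 : P.a 0 ≠ 0 := by tauto
    refine hasDynamicalDegree_of_invariant hr hα ![1, 5, 4] (by decide)
      (fun d => 0 < d 0 ∧ 2 * d 0 < d 1 ∧ d 2 < d 1 ∧ d 1 < 2 * d 2) 1 2 0 3 1 1 3 ((1 + √13) / 2)
      (by positivity) (by positivity) (by positivity) (by push_cast; ring)
      (by push_cast; linear_combination -s13 / 4)
      (by decide) ?_ ?_
    · rintro d d' hs ⟨i1, i2, i3, i4⟩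
      have e0 := hs.eq 0 3 (by omega) (by omega) (.inl (by decide)) (by simp [cubicCoeff, *])
        (by intro l hl he
            fin_cases l <;> simp [cubicCoeff, cubicDegree, *] at hl he ⊢
            omega)
      have e1 := hs.eq 1 7 (by omega) (by omega) (.inl (by decide)) (by simp [cubicCoeff, *])
        (by intro l hl he
            fin_cases l <;> simp [cubicCoeff, cubicDegree, *] at hl he ⊢ <;> omega)
      have e2 := hs.eq 2 4 (by omega) (by omega) (by omega) (by simp [cubicCoeff, *])
        (by intro l hl he
            fin_cases l <;> simp [cubicCoeff, cubicDegree, *] at hl he ⊢ <;> omega)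
      simp [cubicDegree] at e0 e1 e2
      omega
    · rintro d ⟨i1, i2, i3, i4⟩ l
      fin_cases l <;> simp <;> omega

end Params

end

/-! ### The dynamical degrees in Cases 2 to 4 and for `α*(z) ∈ k[z]`. -/

section

variable {k : Type*} [Field k]

namespace Params

/-- The recurrence couples `f_1` and `f_3`, led by `x²z` and `x²` if `a_0 ≠ 0`, and by `xz²` and
`xz` otherwise. The characteristic polynomials are `λ² - 2λ - 2` and `λ² - 2λ - 1`. -/
theorem hasDynamicalDegree_case2 {P : Params k} (hr : P.r.natDegree ≤ 3)
    {A : Matrix (Fin 3) (Fin 3) k} {c : Fin 3 → k} (hα : P.α = affineMap A c) (hA : A.det ≠ 0)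
    (hr3 : P.r.coeff 3 = 0) (ha : P.a 0 ≠ 0 ∨ P.a 1 ≠ 0) (h10 : A 1 0 = 0) (h11 : A 1 1 = 0)
    (h20 : A 2 0 = 0) :
    (P.a 0 ≠ 0 → HasDynamicalDegree P.f (1 + √3)) ∧
      (P.a 0 = 0 → HasDynamicalDegree P.f (1 + √2)) := by
  have hdet := det_fin_three_ne_zero hA
  have h12 : A 1 2 ≠ 0 := fun h => hdet (by rw [h10, h11, h]; ring)
  have h21 : A 2 1 ≠ 0 := fun h => hdet (by rw [h10, h11, h20, h]; ring)
  have h00 : A 0 0 ≠ 0 := fun h => hdet (by rw [h10, h11, h20, h]; ring)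
  have s2 : (√2) ^ 2 = 2 := Real.sq_sqrt (by norm_num)
  have s3 : (√3) ^ 2 = 3 := Real.sq_sqrt (by norm_num)
  constructor
  · intro ha0
    refine hasDynamicalDegree_of_invariant hr hα ![2, 1, 1] (by decide)
      (fun d => 0 < d 2 ∧ d 2 < d 0 ∧ d 1 < 2 * d 0) 0 2 2 1 2 0 (1 + √3) 2
      (by positivity) two_pos (by positivity) (by push_cast; linear_combination -s3) (by push_cast; ring)
      (by decide) ?_ ?_
    · rintro d d' hs ⟨i1, i2, i3⟩
      have e0 := hs.eq 0 5 (by omega) (by omega) (.inl (by decide)) (by simp [cubicCoeff, *])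
        (by intro l hl he
            fin_cases l <;> simp [cubicCoeff, cubicDegree, *] at hl he ⊢ <;> omega)
      have e1 := hs.eq 1 3 (by omega) (by omega) (.inl (by decide)) (by simp [cubicCoeff, *])
        (by intro l hl he
            fin_cases l <;> simp [cubicCoeff, cubicDegree, *] at hl he ⊢)
      have e2 := hs.eq 2 10 (by omega) (by omega) (.inl (by decide)) (by simp [cubicCoeff, *])
        (by intro l hl he
            fin_cases l <;> simp [cubicCoeff, cubicDegree, *] at hl he ⊢ <;> omega)
      simp [cubicDegree] at e0 e1 e2
      omega
    · rintro d ⟨i1, i2, i3⟩ l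
      fin_cases l <;> simp <;> omega
  · intro ha0
    have ha1 : P.a 1 ≠ 0 := by tauto
    refine hasDynamicalDegree_of_invariant hr hα ![2, 1, 1] (by decide)
      (fun d => 0 < d 2 ∧ d 2 < d 0 ∧ d 1 < d 0 + d 2) 0 2 1 2 1 1 √2 1
      (by positivity) one_pos (by positivity) (by push_cast; linear_combination -s2) (by push_cast; ring)
      (by decide) ?_ ?_
    · rintro d d' hs ⟨i1, i2, i3⟩
      have e0 := hs.eq 0 6 (by omega) (by omega) (.inl (by decide)) (by simp [cubicCoeff, *])
        (by intro l hl he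
            fin_cases l <;> simp [cubicCoeff, cubicDegree, *] at hl he ⊢ <;> omega)
      have e1 := hs.eq 1 3 (by omega) (by omega) (.inl (by decide)) (by simp [cubicCoeff, *])
        (by intro l hl he
            fin_cases l <;> simp [cubicCoeff, cubicDegree, *] at hl he ⊢)
      have e2 := hs.eq 2 8 (by omega) (by omega) (.inl (by decide)) (by simp [cubicCoeff, *])
        (by intro l hl he
            fin_cases l <;> simp [cubicCoeff, cubicDegree, *] at hl he ⊢ <;> omega)
      simp [cubicDegree] at e0 e1 e2
      omega
    · rintro d ⟨i1, i2, i3⟩ l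
      fin_cases l <;> simp <;> omega

/-- Here `f_1` is led by `z²` if `r_2 ≠ 0`, and otherwise by `xz` or `x²` according to `a_1`; `f_3`
is led by `xz²` if `a_1 ≠ 0` and by `x²z` if not. In the order of the statement the characteristic
polynomials are `λ² - 2λ - 2`, `λ² - 3λ + 1`, `λ² - λ - 4` and `(λ - 2)(λ - 1)`. -/
theorem hasDynamicalDegree_case3 {P : Params k} (hr : P.r.natDegree ≤ 3)
    {A : Matrix (Fin 3) (Fin 3) k} {c : Fin 3 → k} (hα : P.α = affineMap A c) (hA : A.det ≠ 0)
    (hr3 : P.r.coeff 3 = 0) (ha : P.a 0 ≠ 0 ∨ P.a 1 ≠ 0) (ha2 : P.a 2 = 0) (h10 : A 1 0 = 0)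
    (h11 : A 1 1 = 0) (h00 : A 0 0 = 0) :
    (P.a 1 ≠ 0 → P.r.coeff 2 ≠ 0 → HasDynamicalDegree P.f (1 + √3)) ∧
      (P.a 1 ≠ 0 → P.r.coeff 2 = 0 → HasDynamicalDegree P.f ((3 + √5) / 2)) ∧
      (P.a 1 = 0 → P.r.coeff 2 ≠ 0 → HasDynamicalDegree P.f ((1 + √17) / 2)) ∧
      (P.a 1 = 0 → P.r.coeff 2 = 0 → HasDynamicalDegree P.f 2) := by
  have hdet := det_fin_three_ne_zero hA
  have h12 : A 1 2 ≠ 0 := fun h => hdet (by rw [h10, h11, h]; ring)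
  have h01 : A 0 1 ≠ 0 := fun h => hdet (by rw [h10, h11, h00, h]; ring)
  have h20 : A 2 0 ≠ 0 := fun h => hdet (by rw [h10, h11, h00, h]; ring)
  have s3 : (√3) ^ 2 = 3 := Real.sq_sqrt (by norm_num)
  have s5 : (√5) ^ 2 = 5 := Real.sq_sqrt (by norm_num)
  have s17 : (√17) ^ 2 = 17 := Real.sq_sqrt (by norm_num)
  refine ⟨fun ha1 hr2 => ?_, fun ha1 hr2 => ?_, fun ha1 hr2 => ?_, fun ha1 hr2 => ?_⟩
  · refine hasDynamicalDegree_of_invariant hr hα ![1, 1, 2] (by decide)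
      (fun d => 0 < d 0 ∧ d 0 < d 2 ∧ d 1 < d 0 + d 2) 0 2 0 2 1 2 2 (1 + √3)
      two_pos (by positivity) (by positivity) (by push_cast; ring) (by push_cast; linear_combination -s3)
      (by decide) ?_ ?_
    · rintro d d' hs ⟨i1, i2, i3⟩
      have e0 := hs.eq 0 9 (by omega) (by omega) (.inl (by decide)) (by simp [cubicCoeff, *])
        (by intro l hl he
            fin_cases l <;> simp [cubicCoeff, cubicDegree, *] at hl he ⊢ <;> omega)
      have e1 := hs.eq 1 3 (by omega) (by omega) (.inl (by decide)) (by simp [cubicCoeff, *])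
        (by intro l hl he
            fin_cases l <;> simp [cubicCoeff, cubicDegree, *] at hl he ⊢
            omega)
      have e2 := hs.eq 2 6 (by omega) (by omega) (.inl (by decide)) (by simp [cubicCoeff, *])
        (by intro l hl he
            fin_cases l <;> simp [cubicCoeff, cubicDegree, *] at hl he ⊢ <;> omega)
      simp [cubicDegree] at e0 e1 e2
      omega
    · rintro d ⟨i1, i2, i3⟩ l
      fin_cases l <;> simp <;> omega
  · refine hasDynamicalDegree_of_invariant hr hα ![1, 1, 2] (by decide)
      (fun d => 0 < d 0 ∧ d 0 < d 2 ∧ d 1 < d 0 + d 2) 0 2 1 1 1 2 2 (1 + √5)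
      two_pos (by positivity) (by positivity) (by push_cast; ring) (by push_cast; linear_combination -s5 / 2)
      (by decide) ?_ ?_
    · rintro d d' hs ⟨i1, i2, i3⟩
      have e0 := hs.eq 0 8 (by omega) (by omega) (.inl (by decide)) (by simp [cubicCoeff, *])
        (by intro l hl he
            fin_cases l <;> simp [cubicCoeff, cubicDegree, *] at hl he ⊢ <;> omega)
      have e1 := hs.eq 1 3 (by omega) (by omega) (.inl (by decide)) (by simp [cubicCoeff, *])
        (by intro l hl he
            fin_cases l <;> simp [cubicCoeff, cubicDegree, *] at hl he ⊢
            omega)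
      have e2 := hs.eq 2 6 (by omega) (by omega) (.inl (by decide)) (by simp [cubicCoeff, *])
        (by intro l hl he
            fin_cases l <;> simp [cubicCoeff, cubicDegree, *] at hl he ⊢ <;> omega)
      simp [cubicDegree] at e0 e1 e2
      omega
    · rintro d ⟨i1, i2, i3⟩ l
      fin_cases l <;> simp <;> omega
  · have ha0 : P.a 0 ≠ 0 := by tauto
    refine hasDynamicalDegree_of_invariant hr hα ![2, 1, 3] (by decide)
      (fun d => d 0 < d 2 ∧ d 2 < 2 * d 0 ∧ d 1 < 2 * d 0) 0 2 0 2 2 1 4 (1 + √17)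
      four_pos (by positivity) (by positivity) (by push_cast; ring) (by push_cast; linear_combination -s17 / 2)
      (by decide) ?_ ?_
    · rintro d d' hs ⟨i1, i2, i3⟩
      have e0 := hs.eq 0 9 (by omega) (by omega) (.inl (by decide)) (by simp [cubicCoeff, *])
        (by intro l hl he
            fin_cases l <;> simp [cubicCoeff, cubicDegree, *] at hl he ⊢ <;> omega)
      have e1 := hs.eq 1 3 (by omega) (by omega) (.inl (by decide)) (by simp [cubicCoeff, *])
        (by intro l hl he
            fin_cases l <;> simp [cubicCoeff, cubicDegree, *] at hl he ⊢
            omega)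
      have e2 := hs.eq 2 5 (by omega) (by omega) (.inl (by decide)) (by simp [cubicCoeff, *])
        (by intro l hl he
            fin_cases l <;> simp [cubicCoeff, cubicDegree, *] at hl he ⊢ <;> omega)
      simp [cubicDegree] at e0 e1 e2
      omega
    · rintro d ⟨i1, i2, i3⟩ l
      fin_cases l <;> simp <;> omega
  · have ha0 : P.a 0 ≠ 0 := by tauto
    refine hasDynamicalDegree_of_invariant hr hα ![1, 1, 1] (by decide)
      (fun d => 0 < d 2 ∧ d 2 < 2 * d 0 ∧ d 1 < 2 * d 0) 0 2 2 0 2 1 1 2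
      one_pos two_pos (by positivity) (by push_cast; ring) (by push_cast; ring)
      (by decide) ?_ ?_
    · rintro d d' hs ⟨i1, i2, i3⟩
      have e0 := hs.eq 0 10 (by omega) (by omega) (.inl (by decide)) (by simp [cubicCoeff, *])
        (by intro l hl he
            fin_cases l <;> simp [cubicCoeff, cubicDegree, *] at hl he ⊢ <;> omega)
      have e1 := hs.eq 1 3 (by omega) (by omega) (.inl (by decide)) (by simp [cubicCoeff, *])
        (by intro l hl he
            fin_cases l <;> simp [cubicCoeff, cubicDegree, *] at hl he ⊢)
      have e2 := hs.eq 2 5 (by omega) (by omega) (.inl (by decide)) (by simp [cubicCoeff, *])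
        (by intro l hl he
            fin_cases l <;> simp [cubicCoeff, cubicDegree, *] at hl he ⊢ <;> omega)
      simp [cubicDegree] at e0 e1 e2
      omega
    · rintro d ⟨i1, i2, i3⟩ l
      fin_cases l <;> simp <;> omega

theorem hasDynamicalDegree_case4 {P : Params k} (hr : P.r.natDegree ≤ 3)
    {A : Matrix (Fin 3) (Fin 3) k} {c : Fin 3 → k} (hα : P.α = affineMap A c) (hA : A.det ≠ 0)
    (hr3 : P.r.coeff 3 = 0) (ha1 : P.a 1 ≠ 0) (ha2 : P.a 2 = 0) (h00 : A 0 0 = 0)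
    (h01 : A 0 1 = 0) (h10 : A 1 0 = 0) :
    HasDynamicalDegree P.f (1 + √2) := by
  have hdet := det_fin_three_ne_zero hA
  have h02 : A 0 2 ≠ 0 := fun h => hdet (by rw [h00, h01, h]; ring)
  have h20 : A 2 0 ≠ 0 := fun h => hdet (by rw [h00, h01, h10, h]; ring)
  have s2 : (√2) ^ 2 = 2 := Real.sq_sqrt (by norm_num)
  refine hasDynamicalDegree_of_invariant hr hα ![1, 1, 2] (by decide)
    (fun d => 0 < d 0 ∧ d 0 < d 2 ∧ d 1 < d 0 + d 2) 0 2 0 1 1 2 1 (1 + √2)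
    one_pos (by positivity) (by positivity) (by push_cast; ring) (by push_cast; linear_combination -s2)
    (by decide) ?_ ?_
  · rintro d d' hs ⟨i1, i2, i3⟩
    have e0 := hs.eq 0 3 (by omega) (by omega) (.inl (by decide)) (by simp [cubicCoeff, *])
      (by intro l hl he
          fin_cases l <;> simp [cubicCoeff, cubicDegree, *] at hl he ⊢
          omega)
    -- An upper bound suffices: the second degree only has to keep `yz` below `xz²` in the third
    -- component.
    have e1 := hs.le 1 (2 * d 2)
      (by intro l he
          fin_cases l <;> simp [cubicCoeff, cubicDegree, *] at he ⊢ <;> omega)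
    have e2 := hs.eq 2 6 (by omega) (by omega) (.inl (by decide)) (by simp [cubicCoeff, *])
      (by intro l hl he
          fin_cases l <;> simp [cubicCoeff, cubicDegree, *] at hl he ⊢ <;> omega)
    simp [cubicDegree] at e0 e2
    omega
  · rintro d ⟨i1, i2, i3⟩ l
    fin_cases l <;> simp <;> omega

/-- The third component keeps degree 1, so `x²z` or `x²` leads `f_1` and the first degree doubles up
to an error of 1. Depending on `α`, the recurrence is not uniform, so the growth is bounded
directly. -/
theorem hasDynamicalDegree_two_of_row {P : Params k} (hr : P.r.natDegree ≤ 3)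
    {A : Matrix (Fin 3) (Fin 3) k} {c : Fin 3 → k} (hα : P.α = affineMap A c) (hA : A.det ≠ 0)
    (ha0 : P.a 0 ≠ 0) (h20 : A 2 0 = 0) (h21 : A 2 1 = 0) : HasDynamicalDegree P.f 2 := by
  have hdet := det_fin_three_ne_zero hA
  have h22 : A 2 2 ≠ 0 := fun h => hdet (by rw [h20, h21, h]; ring)
  -- Starting from weight 4 makes the `x²` terms dominate at once. Bounding `d 0 + 1` absorbs the
  -- error, since `(2d + 1) + 1 = 2(d + 1)`.
  have key := invariant_orbit hr hα (w := ![4, 1, 1])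
    (I := fun m d => 2 ^ m + 1 ≤ d 0 ∧ 4 ≤ d 0 ∧ d 0 + 1 ≤ 5 * 2 ^ m ∧ d 1 ≤ d 0 + 1 ∧ d 2 = 1)
    (by decide) ?_
  · refine hasDynamicalDegree_of_bounds (w := ![4, 1, 1]) (by decide) two_pos one_pos
      (C := 5) (by norm_num) 0 (fun m => ?_) fun m j => ?_
    · have := (key m).1
      rw [one_mul]
      exact_mod_cast (Nat.le_succ _).trans this
    · have := key m
      dsimp only at this
      norm_cast
      fin_cases j <;> dsimp only [Fin.reduceFinMk, Fin.zero_eta, Fin.mk_one] <;> omega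
  · rintro m d d' hs ⟨i1, i2, i3, i4, i5⟩
    have e2 := hs.eq 2 3 (by omega) (by omega) (.inl (by decide)) (by simp [cubicCoeff, *])
      (by intro l hl he
          fin_cases l <;> simp [cubicCoeff, cubicDegree, *] at hl he ⊢)
    have e1 := hs.le 1 (2 * d 0 + 1)
      (by intro l he
          fin_cases l <;> simp [cubicCoeff, cubicDegree, *] at he ⊢ <;> omega)
    have e0 : 2 * d 0 ≤ d' 0 ∧ d' 0 ≤ 2 * d 0 + 1 := by
      by_cases h00 : A 0 0 = 0
      · have h01 : A 0 1 ≠ 0 := fun h => hdet (by rw [h20, h21, h00, h]; ring)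
        have e0 := hs.eq 0 10 (by omega) (by omega) (.inl (by decide)) (by simp [cubicCoeff, *])
          (by intro l hl he
              fin_cases l <;> simp [cubicCoeff, cubicDegree, *] at hl he ⊢ <;> omega)
        simp [cubicDegree] at e0
        omega
      · have e0 := hs.eq 0 5 (by omega) (by omega) (.inl (by decide)) (by simp [cubicCoeff, *])
          (by intro l hl he
              fin_cases l <;> simp [cubicCoeff, cubicDegree, *] at hl he ⊢ <;> omega)
        simp [cubicDegree] at e0
        omega
    simp [cubicDegree] at e2
    rw [pow_succ]
    omega

theorem isAut_iter {n : ℕ} {f : Endo k n} (hf : IsAut f) (m : ℕ) : IsAut (iter f m) := by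
  induction m with
  | zero => exact ⟨idMap k n, by simp [iter], by simp [iter]⟩
  | succ m ih => exact isAut_comp hf ih

theorem hasDynamicalDegree_one_of_le {n : ℕ} [NeZero n] {f : Endo k n} (hf : IsAut f)
    (hu : ∀ m, degree (iter f m) ≤ 2 * m + 1) : HasDynamicalDegree f 1 := by
  have hl : ∀ m, 1 ≤ degree (iter f m) := fun m =>
    (Nat.one_le_iff_ne_zero.2 ((isAut_iter hf m).totalDegree_ne_zero 0)).trans
      (totalDegree_le_degree _ 0)
  have h2 : Tendsto (fun m : ℕ => (2 * m + 1 : ℝ)) atTop atTop :=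
    tendsto_atTop_add_const_right _ _
      (tendsto_natCast_atTop_atTop.const_mul_atTop two_pos)
  -- At `2m + 1`, these constants turn the exponent into `1 / m`.
  have h := (tendsto_rpow_div_mul_add 1 (1 / 2) (-1 / 2) (by norm_num)).comp h2
  refine tendsto_of_tendsto_of_tendsto_of_le_of_le tendsto_const_nhds h (fun m => ?_) fun m => ?_
  · exact Real.one_le_rpow (by exact_mod_cast hl m) (by positivity)
  · have e : (1 / (1 / 2 * (2 * m + 1) + -1 / 2) : ℝ) = 1 / m := by congr 1; ring
    simp only [Function.comp, e]
    exact Real.rpow_le_rpow (by positivity) (by exact_mod_cast hu m) (by positivity)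

/-- Without `x²`, every monomial is at most linear in `(x, y)`, and `z` keeps degree at most 1. Each
step then adds at most 2 to the degrees. -/
theorem hasDynamicalDegree_one_of_row {P : Params k} (hf : IsAut P.f) (hr : P.r.natDegree ≤ 3)
    {A : Matrix (Fin 3) (Fin 3) k} {c : Fin 3 → k} (hα : P.α = affineMap A c)
    (ha0 : P.a 0 = 0) (h20 : A 2 0 = 0) (h21 : A 2 1 = 0) : HasDynamicalDegree P.f 1 := by
  have key := invariant_orbit hr hα (w := ![1, 1, 1])
    (I := fun m d => d 0 ≤ 2 * m + 1 ∧ d 1 ≤ 2 * m + 1 ∧ d 2 ≤ 1)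
    (by decide) ?_
  · refine hasDynamicalDegree_one_of_le hf fun m =>
      degree_iter_le (w := ![1, 1, 1]) (by decide) fun j => ?_
    have := key m
    dsimp only at this
    fin_cases j <;> dsimp only [Fin.reduceFinMk, Fin.zero_eta, Fin.mk_one] <;> omega
  · rintro m d d' hs ⟨i1, i2, i3⟩
    refine ⟨hs.le 0 _ ?_, hs.le 1 _ ?_, hs.le 2 _ ?_⟩ <;> intro l he <;>
      fin_cases l <;> simp [cubicCoeff, cubicDegree, *] at he ⊢ <;> omega

end Params

end

section

variable {k : Type*} [Field k]

/-! ### Algebraic stability -/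

/-- A binary quadratic form over an algebraically closed field is a product of linear forms, and a
nonzero linear form vanishes at `(x, z)` only if the two are proportional over `k`. -/
theorem quadratic_ne_zero [IsAlgClosed k] {K : Type*} [CommRing K] [IsDomain K] [Algebra k K]
    {x z : K} (hz : z ≠ 0) (hx : ∀ b : k, x ≠ algebraMap k K b * z) {s t u : k}
    (h : s ≠ 0 ∨ t ≠ 0 ∨ u ≠ 0) :
    algebraMap k K s * x ^ 2 + algebraMap k K t * (x * z) + algebraMap k K u * z ^ 2 ≠ 0 := by
  have hinj : ∀ {b : k}, algebraMap k K b = 0 → b = 0 := fun {b} hb => by simpa using hb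
  intro h0
  by_cases hs : s = 0
  · subst hs
    have h1 : z * (algebraMap k K t * x + algebraMap k K u * z) = 0 := by
      rw [map_zero] at h0
      linear_combination h0
    have h2 := (mul_eq_zero.1 h1).resolve_left hz
    by_cases ht : t = 0
    · subst ht
      rw [map_zero, zero_mul, zero_add] at h2
      have := hinj ((mul_eq_zero.1 h2).resolve_right hz)
      simp_all
    · refine hx (-(u / t)) (mul_left_cancel₀ (a := algebraMap k K t) (fun h => ht (hinj h)) ?_)
      rw [← mul_assoc, ← map_mul, show t * -(u / t) = -u by field_simp, map_neg]
      linear_combination h2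
  · obtain ⟨ρ, hρ⟩ := IsAlgClosed.exists_root (Polynomial.C s * Polynomial.X ^ 2 +
      Polynomial.C t * Polynomial.X + Polynomial.C u) (by
        rw [Polynomial.degree_quadratic hs]; decide)
    have hρ' : s * ρ ^ 2 + t * ρ + u = 0 := by simpa [Polynomial.IsRoot] using hρ
    have hu : u = -(s * ρ ^ 2 + t * ρ) := by linear_combination hρ'
    have hst : s * (-(t / s) - ρ) = -t - s * ρ := by field_simp
    have h1 : (x - algebraMap k K ρ * z) *
        (algebraMap k K s * (x - algebraMap k K (-(t / s) - ρ) * z)) = 0 := by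
      rw [mul_sub (algebraMap k K s), ← mul_assoc (algebraMap k K s), ← map_mul, hst]
      rw [hu] at h0
      simp only [map_neg, map_add, map_mul, map_sub, map_pow] at h0 ⊢
      linear_combination h0
    rcases mul_eq_zero.1 h1 with h2 | h2
    · exact hx ρ (sub_eq_zero.1 h2)
    · rcases mul_eq_zero.1 h2 with h3 | h3
      · exact hs (hinj h3)
      · exact hx _ (sub_eq_zero.1 h3)

namespace Params

/-- The coefficients of degree `N` of `v_0` and `v_2` determine those of degree `3 N` of a cubic
combination. -/
theorem coeff_cubic {K : Type*} [CommRing K] [Algebra k K] (P : Params k)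
    (b : Fin 3 → k) (c : k) {v : Fin 3 → Polynomial K} {N : ℕ} (hN : 0 < N)
    (hv : ∀ i, (v i).natDegree ≤ N) :
    (cubic (P.cubicCoeff b c) v).coeff (3 * N) = (v 2).coeff N *
      (algebraMap k K (b 0 * P.a 0) * (v 0).coeff N ^ 2 +
        algebraMap k K (b 0 * P.a 1) * ((v 0).coeff N * (v 2).coeff N) +
        algebraMap k K (b 0 * P.a 2 + b 1 * P.r.coeff 3) * (v 2).coeff N ^ 2) := by
  -- Since `N > 0`, monomials with at most two factors do not reach degree `3 * N`. Only `x²z`,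
  -- `xz²` and `z³` contribute.
  have low : ∀ p : Polynomial K, p.natDegree ≤ 2 * N → p.coeff (3 * N) = 0 := fun p hp =>
    Polynomial.coeff_eq_zero_of_natDegree_lt (by omega)
  have hm : ∀ i j, (v i * v j).natDegree ≤ 2 * N := fun i j =>
    Polynomial.natDegree_mul_le.trans (by have := hv i; have := hv j; omega)
  have hm2 : ∀ i j, (v i * v j).coeff (2 * N) = (v i).coeff N * (v j).coeff N := fun i j => by
    rw [two_mul]; exact Polynomial.coeff_mul_add_eq_of_natDegree_le (hv i) (hv j)
  have hm3 : ∀ i j l, (v i * v j * v l).coeff (3 * N) =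
      (v i).coeff N * (v j).coeff N * (v l).coeff N := fun i j l => by
    rw [show 3 * N = 2 * N + N by ring, Polynomial.coeff_mul_add_eq_of_natDegree_le (hm i j) (hv l), hm2]
  have hm3' : ∀ i j l, (v i * (v j * v l)).coeff (3 * N) =
      (v i).coeff N * (v j).coeff N * (v l).coeff N := fun i j l => by rw [← mul_assoc, hm3]
  have h1 : ∀ i, (v i).coeff (3 * N) = 0 := fun i => low _ ((hv i).trans (by omega))
  have h2 : ∀ i j, (v i * v j).coeff (3 * N) = 0 := fun i j => low _ (hm i j)
  have h3 : (1 : Polynomial K).coeff (3 * N) = 0 := low _ (by simp)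
  have h4 : ∀ e : Fin 11 → k, (cubic e v).coeff (3 * N) =
      ∑ j, algebraMap k K (e j) * (cubicMonomial v j).coeff (3 * N) := fun e => by
    simp only [cubic, Polynomial.algebraMap_apply, Polynomial.finsetSum_coeff,
      Polynomial.coeff_C_mul]
  rw [h4]
  simp only [Fin.sum_univ_succ, cubicMonomial, pow_succ, pow_zero, one_mul]
  simp [cubicCoeff, hm3, hm3', h1, h2, h3]
  ring

theorem natDegree_orbit_one_le {P : Params k} (hr : P.r.natDegree ≤ 3)
    {A : Matrix (Fin 3) (Fin 3) k} {c : Fin 3 → k} (hα : P.α = affineMap A c) (m : ℕ) (i : Fin 3) :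
    (orbit P.f (weightPoint k ![1, 1, 1]) m i).natDegree ≤ 3 ^ m := by
  have := invariant_orbit hr hα (w := ![1, 1, 1]) (I := fun m d => ∀ i, d i ≤ 3 ^ m) (by decide)
    (fun m d d' hs hd i => hs.le i _ fun l _ => by
      have := hd 0
      have := hd 1
      have := hd 2
      have := Nat.one_le_pow m 3 (by norm_num)
      rw [pow_succ]
      fin_cases l <;> simp [cubicDegree] <;> omega) m
  exact this i

/-- The coefficient of `t ^ (3 ^ m)` in the `i`-th component of the `m`-th iterate. -/
def topCoeff (P : Params k) (m : ℕ) (i : Fin 3) : MvPolynomial (Fin 3) k :=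
  (orbit P.f (weightPoint k ![1, 1, 1]) m i).coeff (3 ^ m)

theorem topCoeff_zero (P : Params k) (i : Fin 3) : P.topCoeff 0 i = X i := by
  rw [topCoeff, orbit_zero, weightPoint]
  fin_cases i <;> simp

theorem topCoeff_succ {P : Params k} (hr : P.r.natDegree ≤ 3) {A : Matrix (Fin 3) (Fin 3) k}
    {c : Fin 3 → k} (hα : P.α = affineMap A c) (m : ℕ) (i : Fin 3) :
    P.topCoeff (m + 1) i = P.topCoeff m 2 *
      (algebraMap k _ (A i 0 * P.a 0) * P.topCoeff m 0 ^ 2 +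
        algebraMap k _ (A i 0 * P.a 1) * (P.topCoeff m 0 * P.topCoeff m 2) +
        algebraMap k _ (A i 0 * P.a 2 + A i 1 * P.r.coeff 3) * P.topCoeff m 2 ^ 2) := by
  rw [topCoeff, P.orbit_succ_eq hr hα, pow_succ, mul_comm,
    coeff_cubic P _ _ (by positivity) (natDegree_orbit_one_le hr hα m)]
  rfl

theorem stable_of_topCoeff_ne_zero {P : Params k} (hr : P.r.natDegree ≤ 3)
    {A : Matrix (Fin 3) (Fin 3) k} {c : Fin 3 → k} (hα : P.α = affineMap A c)
    (h : ∀ m, P.topCoeff m 2 ≠ 0) : IsAlgebraicallyStable P.f ∧ HasDynamicalDegree P.f 3 := by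
  have hd : ∀ m, degree (iter P.f m) = 3 ^ m := fun m => by
    refine le_antisymm (degree_iter_le (w := ![1, 1, 1]) (by decide)
      (natDegree_orbit_one_le hr hα m)) ?_
    have h1 := natDegree_orbit_le P.f (w := ![1, 1, 1]) (W := 1) (by decide) m 2
    have h2 := Polynomial.le_natDegree_of_ne_zero (h m)
    omega
  have h1 : degree P.f = 3 := by
    have := hd 1
    simpa [iter] using this
  constructor
  · intro m _
    rw [hd, h1]
  · refine tendsto_rpow_one_div_of_bounds (c := 1) (C := 1) three_pos one_pos one_pos ?_ ?_ <;>
      simp [hd]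

theorem X_zero_ne_algebraMap_mul_X_two (b : k) :
    (X 0 : MvPolynomial (Fin 3) k) ≠ algebraMap k _ b * X 2 := by
  intro h
  have := congrArg (aeval (![1, 0, 0] : Fin 3 → k)) h
  simp at this

/-- If the linear parts of the first and third component are independent on the leading terms,
then `f` is algebraically stable. -/
theorem stable_of_independent [IsAlgClosed k] {P : Params k} (hr : P.r.natDegree ≤ 3)
    (ha : P.a 0 ≠ 0 ∨ P.a 1 ≠ 0) {A : Matrix (Fin 3) (Fin 3) k} {c : Fin 3 → k}
    (hα : P.α = affineMap A c)
    (h0 : A 2 0 ≠ 0 ∨ A 2 1 * P.r.coeff 3 ≠ 0)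
    (h : ∀ b : k, A 0 0 - b * A 2 0 ≠ 0 ∨ (A 0 1 - b * A 2 1) * P.r.coeff 3 ≠ 0) :
    IsAlgebraicallyStable P.f ∧ HasDynamicalDegree P.f 3 := by
  -- As `(a_0, a_1) ≠ (0, 0)`, the quadratic part of `a` is independent of `z²`. Independence of the
  -- forms thus reduces to that of the vectors `(A i 0, A i 1 * r_3)`.
  have hq : ∀ s t : k, s ≠ 0 ∨ t * P.r.coeff 3 ≠ 0 →
      s * P.a 0 ≠ 0 ∨ s * P.a 1 ≠ 0 ∨ s * P.a 2 + t * P.r.coeff 3 ≠ 0 := by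
    intro s t hst
    by_cases hs : s = 0
    · subst hs
      simpa using hst
    · rcases ha with ha | ha
      · exact .inl (mul_ne_zero hs ha)
      · exact .inr (.inl (mul_ne_zero hs ha))
  have key : ∀ m, P.topCoeff m 2 ≠ 0 ∧
      ∀ b : k, P.topCoeff m 0 ≠ algebraMap k _ b * P.topCoeff m 2 := by
    intro m
    induction m with
    | zero =>
      simp only [topCoeff_zero]
      exact ⟨X_ne_zero 2, X_zero_ne_algebraMap_mul_X_two⟩
    | succ m ih =>
      obtain ⟨i1, i2⟩ := ih
      refine ⟨?_, fun b hb => ?_⟩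
      · rw [topCoeff_succ hr hα]
        exact mul_ne_zero i1 (quadratic_ne_zero i1 i2 (hq _ _ h0))
      · rw [topCoeff_succ hr hα, topCoeff_succ hr hα] at hb
        refine mul_ne_zero i1 (quadratic_ne_zero i1 i2 (hq _ _ (h b))) ?_
        simp only [map_mul, map_add, map_sub] at hb ⊢
        linear_combination hb
  exact stable_of_topCoeff_ne_zero hr hα fun m => (key m).1

/-- From the first iterate on, the two top coefficients have the fixed ratio `b`. The third is then
cubed at each step and multiplied by the constant in `h`, the value of `q_2` at `(b, 1)`. -/
theorem stable_of_dependent {P : Params k} (hr : P.r.natDegree ≤ 3) {A : Matrix (Fin 3) (Fin 3) k} {c : Fin 3 → k}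
    (hα : P.α = affineMap A c) {b : k} (h0 : A 0 0 = b * A 2 0)
    (h1 : A 0 1 * P.r.coeff 3 = b * (A 2 1 * P.r.coeff 3))
    (h : A 2 0 * (P.a 0 * b ^ 2 + P.a 1 * b + P.a 2) + A 2 1 * P.r.coeff 3 ≠ 0) :
    IsAlgebraicallyStable P.f ∧ HasDynamicalDegree P.f 3 := by
  have key : ∀ m, P.topCoeff (m + 1) 2 ≠ 0 ∧
      P.topCoeff (m + 1) 0 = algebraMap k _ b * P.topCoeff (m + 1) 2 := by
    intro m
    have hb : ∀ m, P.topCoeff (m + 1) 0 = algebraMap k _ b * P.topCoeff (m + 1) 2 := fun m => by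
      rw [topCoeff_succ hr hα, topCoeff_succ hr hα, h0, h1]
      simp only [map_mul, map_add]
      ring
    refine ⟨?_, hb m⟩
    induction m with
    | zero =>
      rw [topCoeff_succ hr hα]
      simp only [topCoeff_zero]
      refine mul_ne_zero (X_ne_zero 2) fun h2 => ?_
      -- At the point `(b, 0, 1)` the form takes exactly the value that `h` excludes from being
      -- zero.
      have e := congrArg (aeval (![b, 0, 1] : Fin 3 → k)) h2
      simp at e
      exact h (by linear_combination e)
    | succ m ih =>
      have e : P.topCoeff (m + 2) 2 = algebraMap k _
          (A 2 0 * (P.a 0 * b ^ 2 + P.a 1 * b + P.a 2) + A 2 1 * P.r.coeff 3) *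
            P.topCoeff (m + 1) 2 ^ 3 := by
        rw [topCoeff_succ hr hα, hb]
        simp only [map_mul, map_add, map_pow]
        ring
      rw [e]
      exact mul_ne_zero ((map_ne_zero _).2 h) (pow_ne_zero _ ih)
  refine stable_of_topCoeff_ne_zero hr hα fun m => ?_
  cases m with
  | zero => rw [topCoeff_zero]; exact X_ne_zero 2
  | succ m => exact (key m).1

end Params

end

section

variable {k : Type*} [Field k] {n : ℕ}

/-! ### Elementary and triangular automorphisms -/

theorem comp_apply (f g : Endo k n) (i : Fin n) : comp f g i = aeval g (f i) := rfl

theorem aeval_congr_of_mem_supported {S : Type*} [CommRing S] [Algebra k S]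
    {p : MvPolynomial (Fin n) k} {s : Set (Fin n)} (hp : p ∈ supported k s) {v w : Fin n → S}
    (h : ∀ i ∈ s, v i = w i) : aeval v p = aeval w p :=
  eval₂Hom_congr' rfl (fun i hi _ => h i (mem_supported.1 hp hi)) rfl

theorem aeval_mem_supported {p : MvPolynomial (Fin n) k} {s t : Set (Fin n)}
    (hp : p ∈ supported k s) {f : Endo k n} (h : ∀ i ∈ s, f i ∈ supported k t) :
    aeval f p ∈ supported k t := by
  classical
  rw [aeval_congr_of_mem_supported hp (w := fun i => if i ∈ s then f i else 0)
    fun i hi => by simp [hi], aeval_def, eval₂_eq']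
  refine sum_mem fun d _ => mul_mem (Subalgebra.algebraMap_mem _ _) (prod_mem fun i _ => ?_)
  refine pow_mem ?_ _
  split_ifs with hi
  · exact h i hi
  · exact zero_mem _

/-- The morphism that adds `p` to the `i`-th coordinate. -/
def elementary (i : Fin n) (p : MvPolynomial (Fin n) k) : Endo k n :=
  Function.update (idMap k n) i (X i + p)

@[simp] theorem elementary_same (i : Fin n) (p : MvPolynomial (Fin n) k) :
    elementary i p i = X i + p := by simp [elementary]

theorem elementary_of_ne {i j : Fin n} (h : j ≠ i) (p : MvPolynomial (Fin n) k) :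
    elementary i p j = X j := by simp [elementary, idMap, h]

theorem aeval_elementary {i : Fin n} {p q : MvPolynomial (Fin n) k}
    (hq : q ∈ supported k {i}ᶜ) : aeval (elementary i p) q = q := by
  rw [aeval_congr_of_mem_supported hq (w := X) fun j hj => elementary_of_ne hj p]
  exact aeval_X_left_apply q

theorem comp_elementary {i : Fin n} {p q : MvPolynomial (Fin n) k}
    (hp : p ∈ supported k {i}ᶜ) :
    comp (elementary i p) (elementary i q) = elementary i (p + q) := by
  funext j
  rw [comp_apply]
  by_cases hj : j = i
  · subst hj
    rw [elementary_same, map_add, aeval_X, aeval_elementary hp, elementary_same, elementary_same]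
    ring
  · rw [elementary_of_ne hj, elementary_of_ne hj, aeval_X, elementary_of_ne hj]

theorem elementary_zero (i : Fin n) : elementary i 0 = idMap k n := by
  simp [elementary, idMap]

theorem isInverse_elementary {i : Fin n} {p : MvPolynomial (Fin n) k}
    (hp : p ∈ supported k {i}ᶜ) : IsInverse (elementary i p) (elementary i (-p)) :=
  ⟨by rw [comp_elementary hp, add_neg_cancel, elementary_zero],
    by rw [comp_elementary (neg_mem hp), neg_add_cancel, elementary_zero]⟩

theorem isAut_elementary {i : Fin n} {p : MvPolynomial (Fin n) k}
    (hp : p ∈ supported k {i}ᶜ) : IsAut (elementary i p) := ⟨_, isInverse_elementary hp⟩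

theorem comp_affineMap_elementary (A : Matrix (Fin n) (Fin n) k) (c : Fin n → k) (i j : Fin n)
    (p : MvPolynomial (Fin n) k) :
    comp (affineMap A c) (elementary i p) j = affineMap A c j + C (A j i) * p := by
  simp only [comp_apply, affineMap, map_add, map_sum, map_mul, aeval_X, aeval_C]
  have : ∀ l, elementary i p l = X l + if l = i then p else 0 := by
    intro l
    by_cases hl : l = i
    · subst hl; simp
    · simp [elementary_of_ne hl, hl]
  simp only [this, mul_add, Finset.sum_add_distrib, MvPolynomial.algebraMap_eq]
  simp
  ring

theorem degree_elementary_le {i : Fin n} {p : MvPolynomial (Fin n) k} {N : ℕ} (hN : 1 ≤ N)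
    (hp : p.totalDegree ≤ N) : degree (elementary i p) ≤ N := by
  refine Finset.sup_le fun j _ => ?_
  by_cases hj : j = i
  · subst hj
    rw [elementary_same]
    exact (totalDegree_add _ _).trans (max_le ((totalDegree_X _).trans_le hN) hp)
  · rw [elementary_of_ne hj]
    exact (totalDegree_X _).trans_le hN

theorem isAffine_of_degree_le {f : Endo k n} (hf : IsAut f) (h : degree f ≤ 1) : IsAffine f :=
  hf.isAffine fun i => (totalDegree_le_degree f i).trans h

theorem IsAffine.degree_le {f : Endo k n} (hf : IsAffine f) : degree f ≤ 1 :=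
  Finset.sup_le fun i _ => (hf.2 i).le

theorem IsAffine.comp_isAffine {f g : Endo k n} (hf : IsAffine f) (hg : IsAffine g) :
    IsAffine (comp f g) :=
  isAffine_of_degree_le (isAut_comp hf.1 hg.1)
    ((degree_comp_le f g).trans (Nat.mul_le_mul hf.degree_le hg.degree_le))

theorem isTriangular_elementary {n : ℕ} {p : MvPolynomial (Fin (n + 1)) k}
    (hp : p ∈ supported k {0}ᶜ) : IsTriangular (elementary 0 p) := by
  refine ⟨isAut_elementary hp, fun i => ?_⟩
  by_cases hi : i = 0
  · subst hi
    rw [show Set.Ici (0 : Fin (n + 1)) = Set.univ from Set.eq_univ_of_forall fun i => Fin.zero_le i,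
      supported_univ]
    trivial
  · rw [elementary_of_ne hi]
    exact X_mem_supported.2 Set.self_mem_Ici

theorem polynomial_aeval_mem_supported {s : Set (Fin n)} {p : MvPolynomial (Fin n) k}
    (hp : p ∈ supported k s) (r : Polynomial k) : Polynomial.aeval p r ∈ supported k s := by
  rw [Polynomial.aeval_eq_sum_range]
  exact sum_mem fun i _ => Subalgebra.smul_mem _ (pow_mem hp i) _

theorem totalDegree_polynomial_aeval_le (p : MvPolynomial (Fin n) k) (r : Polynomial k) :
    (Polynomial.aeval p r).totalDegree ≤ r.natDegree * p.totalDegree := by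
  rw [Polynomial.aeval_eq_sum_range]
  refine (totalDegree_finsetSum _ _).trans (Finset.sup_le fun i hi => ?_)
  refine (totalDegree_smul_le _ _).trans ((totalDegree_pow _ _).trans ?_)
  exact Nat.mul_le_mul_right _ (Nat.lt_succ_iff.1 (Finset.mem_range.1 hi))

theorem aeval_polynomial_aeval {S : Type*} [CommRing S] [Algebra k S] (v : Fin n → S)
    (p : MvPolynomial (Fin n) k) (r : Polynomial k) :
    aeval v (Polynomial.aeval p r) = Polynomial.aeval (aeval v p) r :=
  (Polynomial.aeval_algHom_apply (aeval v) p r).symm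

theorem isConjBy_of_comp {f t s s' : Endo k n} (hs : IsInverse s s') (hf : f = comp t s) :
    IsConjBy s f (comp s t) :=
  ⟨s', hs, by rw [hf, comp_assoc, hs.1, comp_idMap]⟩

theorem totalDegree_add_le_of_le {p q : MvPolynomial (Fin n) k} {N : ℕ} (hp : p.totalDegree ≤ N)
    (hq : q.totalDegree ≤ N) : (p + q).totalDegree ≤ N :=
  (totalDegree_add _ _).trans (max_le hp hq)

theorem totalDegree_mul_le_of_le {p q : MvPolynomial (Fin n) k} {M N : ℕ}
    (hp : p.totalDegree ≤ M) (hq : q.totalDegree ≤ N) : (p * q).totalDegree ≤ M + N :=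
  (totalDegree_mul _ _).trans (Nat.add_le_add hp hq)

theorem totalDegree_C_mul_le (b : k) (p : MvPolynomial (Fin n) k) :
    (C b * p).totalDegree ≤ p.totalDegree := by
  have := totalDegree_mul (C b) p
  rwa [totalDegree_C, zero_add] at this

namespace Params

theorem totalDegree_aPoly_le (P : Params k) : P.aPoly.totalDegree ≤ 2 := by
  have hX : ∀ i, (X i : MvPolynomial (Fin 3) k).totalDegree ≤ 1 := fun i => (totalDegree_X i).le
  have hX2 : ∀ i, (X i ^ 2 : MvPolynomial (Fin 3) k).totalDegree ≤ 2 := fun i =>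
    (totalDegree_X_pow i 2).le
  have h1 : ∀ (b : k) i, (C b * X i : MvPolynomial (Fin 3) k).totalDegree ≤ 1 := fun b i =>
    (totalDegree_C_mul_le _ _).trans (hX i)
  have h2 : ∀ (b : k) i, (C b * X i ^ 2 : MvPolynomial (Fin 3) k).totalDegree ≤ 2 := fun b i =>
    (totalDegree_C_mul_le _ _).trans (hX2 i)
  exact totalDegree_add_le_of_le (totalDegree_add_le_of_le (totalDegree_add_le_of_le
    (totalDegree_add_le_of_le (h2 _ _) (totalDegree_mul_le_of_le (h1 _ _) (hX _))) (h2 _ _))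
    ((h1 _ _).trans one_le_two)) ((h1 _ _).trans one_le_two)

theorem aPoly_mem_supported (P : Params k) : P.aPoly ∈ supported k {1}ᶜ := by
  have h0 : (X 0 : MvPolynomial (Fin 3) k) ∈ supported k {1}ᶜ := X_mem_supported.2 (by simp)
  have h2 : (X 2 : MvPolynomial (Fin 3) k) ∈ supported k {1}ᶜ := X_mem_supported.2 (by simp)
  have hC : ∀ b : k, (C b : MvPolynomial (Fin 3) k) ∈ supported k {1}ᶜ := fun b =>
    Subalgebra.algebraMap_mem _ b
  exact add_mem (add_mem (add_mem (add_mem (mul_mem (hC _) (pow_mem h0 2))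
    (mul_mem (mul_mem (hC _) h0) h2)) (mul_mem (hC _) (pow_mem h2 2)))
    (mul_mem (hC _) h0)) (mul_mem (hC _) h2)

theorem r_mem_supported (P : Params k) {s : Set (Fin 3)} (hs : 2 ∈ s) :
    Polynomial.aeval (X 2 : MvPolynomial (Fin 3) k) P.r ∈ supported k s :=
  polynomial_aeval_mem_supported (X_mem_supported.2 hs) _

/-- The second coordinate shift in the decomposition of `g`. -/
def shiftX (P : Params k) : MvPolynomial (Fin 3) k :=
  X 2 * (X 1 + C P.ξ - Polynomial.aeval (X 2) P.r)

/-- The first coordinate shift in the decomposition of `g`. -/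
def shiftY (P : Params k) : MvPolynomial (Fin 3) k := P.aPoly + Polynomial.aeval (X 2) P.r

theorem shiftX_mem_supported (P : Params k) : P.shiftX ∈ supported k {0}ᶜ :=
  mul_mem (X_mem_supported.2 (by simp)) (sub_mem (add_mem (X_mem_supported.2 (by simp))
    (Subalgebra.algebraMap_mem _ P.ξ)) (P.r_mem_supported (by simp)))

theorem shiftY_mem_supported (P : Params k) : P.shiftY ∈ supported k {1}ᶜ :=
  add_mem P.aPoly_mem_supported (P.r_mem_supported (by simp))

/-- The outer factor subtracts `r(z)` in `shiftX` because the inner one has already added it to `y`,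
whereas the first component of `g` contains no `z r(z)`. -/
theorem g_eq_comp (P : Params k) :
    P.g = comp (elementary 0 P.shiftX) (elementary 1 P.shiftY) := by
  have e0 : elementary 1 P.shiftY 0 = X 0 := elementary_of_ne (by decide) _
  have e2 : elementary 1 P.shiftY 2 = X 2 := elementary_of_ne (by decide) _
  funext i
  rw [comp_apply]
  fin_cases i
  · simp only [g, Fin.zero_eta, elementary_same, map_add, aeval_X, shiftX, map_mul, map_sub,
      aeval_polynomial_aeval, e0, e2, aeval_C, MvPolynomial.algebraMap_eq]
    simp only [Matrix.cons_val_zero, shiftY]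
    ring
  · rw [Fin.mk_one, elementary_of_ne (by decide), aeval_X, elementary_same, shiftY]
    simp only [g, Matrix.cons_val_one, Matrix.cons_val_zero]
    ring
  · change X 2 = aeval (elementary 1 P.shiftY) (elementary 0 P.shiftX 2)
    rw [elementary_of_ne (by decide), aeval_X, e2]

theorem isAut_f (P : Params k) (h : IsAffine P.α) : IsAut P.f := by
  rw [f, g_eq_comp]
  exact isAut_comp h.1 (isAut_comp (isAut_elementary P.shiftX_mem_supported)
    (isAut_elementary P.shiftY_mem_supported))

/-- Only `α*(y)` involves `x`, so `shiftY` evaluated at `α` is a polynomial in `y` and `z`. Adding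
it after `α` to the second coordinate amounts to adding a multiple of it to `x` before `α`.
Conjugation by this elementary factor leaves `α` times an elementary map in `x`. -/
theorem exists_conj_affineTriangular_of_col {P : Params k} (hr : P.r.natDegree ≤ 2)
    (hP : IsAffine P.α) {A : Matrix (Fin 3) (Fin 3) k} {c : Fin 3 → k} (hα : P.α = affineMap A c)
    (h00 : A 0 0 = 0) (h20 : A 2 0 = 0) (h10 : A 1 0 ≠ 0) :
    ∃ φ h : Endo k 3, IsConjBy φ P.f h ∧ IsAffineTriangular h ∧ degree h ≤ 3 := by
  have hα0 : ∀ i ∈ ({1}ᶜ : Set (Fin 3)), P.α i ∈ supported k {0}ᶜ := by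
    intro i hi
    rw [hα, affineMap_mem_supported_iff]
    intro j hj
    obtain rfl : j = 0 := by simpa using hj
    fin_cases i
    · exact h00
    · exact absurd rfl hi
    · exact h20
  have hp : C (A 1 0)⁻¹ * aeval P.α P.shiftY ∈ supported k {0}ᶜ :=
    mul_mem (Subalgebra.algebraMap_mem _ _) (aeval_mem_supported P.shiftY_mem_supported hα0)
  have h1 : comp (elementary 1 P.shiftY) P.α =
      comp P.α (elementary 0 (C (A 1 0)⁻¹ * aeval P.α P.shiftY)) := by
    funext i
    rw [comp_apply]
    conv_rhs => rw [hα, comp_affineMap_elementary, ← hα]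
    by_cases hi : i = 1
    · subst hi
      rw [elementary_same, map_add, aeval_X, ← mul_assoc, ← C_mul, mul_inv_cancel₀ h10, C_1, one_mul]
    · rw [elementary_of_ne hi, aeval_X]
      have : A i 0 = 0 := by fin_cases i <;> simp_all
      rw [this, C_0, zero_mul, add_zero]
  have h2 : comp (elementary 1 P.shiftY) (comp P.α (elementary 0 P.shiftX)) =
      comp P.α (elementary 0 (C (A 1 0)⁻¹ * aeval P.α P.shiftY + P.shiftX)) := by
    rw [← comp_assoc, h1, comp_assoc, comp_elementary hp]
  refine ⟨elementary 1 P.shiftY, _, isConjBy_of_comp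
    (isInverse_elementary P.shiftY_mem_supported) (t := comp P.α (elementary 0 P.shiftX))
    (by rw [f, g_eq_comp, comp_assoc]), ?_, ?_⟩
  · exact ⟨P.α, _, hP, isTriangular_elementary (add_mem hp P.shiftX_mem_supported), h2⟩
  · rw [h2]
    have hr' : (Polynomial.aeval (X 2 : MvPolynomial (Fin 3) k) P.r).totalDegree ≤ 2 :=
      (totalDegree_polynomial_aeval_le _ _).trans (by rw [totalDegree_X]; omega)
    refine (degree_comp_le _ _).trans (Nat.mul_le_mul hP.degree_le
      (degree_elementary_le (N := 3) (by norm_num) ?_))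
    refine totalDegree_add_le_of_le ?_ ?_
    · refine (totalDegree_C_mul_le _ _).trans ((totalDegree_aeval_le _ _).trans ?_)
      refine (Nat.mul_le_mul (totalDegree_add_le_of_le P.totalDegree_aPoly_le hr')
        hP.degree_le).trans (by norm_num)
    · refine totalDegree_mul_le_of_le (M := 1) (N := 2) (totalDegree_X _).le ?_
      refine (totalDegree_sub _ _).trans (max_le (totalDegree_add_le_of_le ?_ ?_) hr')
      · rw [totalDegree_X]; norm_num
      · rw [totalDegree_C]; norm_num

end Params

end

/-! ### The second reduction to an affine-triangular map. -/

section

variable {k : Type*} [Field k]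

namespace Params

/-- With `a_1 = a_2 = 0`, evaluating `a` at `α` gives a polynomial in `z` plus `a_4 α*(z)`. The
first summand can be moved to the right of `α` as a triangular map, and the second is an affine
correction on the left. -/
theorem exists_conj_affineTriangular_of_rows {P : Params k} (hr : P.r.natDegree ≤ 2)
    (hP : IsAffine P.α) {A : Matrix (Fin 3) (Fin 3) k} {c : Fin 3 → k} (hα : P.α = affineMap A c)
    (h00 : A 0 0 = 0) (h01 : A 0 1 = 0) (h10 : A 1 0 = 0) (h11 : A 1 1 ≠ 0) (h20 : A 2 0 ≠ 0)
    (ha1 : P.a 1 = 0) (ha2 : P.a 2 = 0) :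
    ∃ φ h : Endo k 3, IsConjBy φ P.f h ∧ IsAffineTriangular h ∧ degree h ≤ 3 := by
  have hα0 : P.α 0 ∈ supported k {2} := by
    rw [hα, affineMap_mem_supported_iff]
    intro j hj
    fin_cases j
    · exact h00
    · exact h01
    · exact absurd rfl hj
  obtain ⟨p, hp⟩ : ∃ p : MvPolynomial (Fin 3) k,
      p = C (A 1 1)⁻¹ * (C (P.a 0) * P.α 0 ^ 2 + C (P.a 3) * P.α 0) := ⟨_, rfl⟩
  have hp' : C (A 1 1) * p = C (P.a 0) * P.α 0 ^ 2 + C (P.a 3) * P.α 0 := by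
    rw [hp, ← mul_assoc, ← C_mul, mul_inv_cancel₀ h11, C_1, one_mul]
  have hps : p ∈ supported k {2} := by
    rw [hp]
    exact mul_mem (Subalgebra.algebraMap_mem _ _) (add_mem
      (mul_mem (Subalgebra.algebraMap_mem _ _) (pow_mem hα0 2))
      (mul_mem (Subalgebra.algebraMap_mem _ _) hα0))
  have hpd : p.totalDegree ≤ 2 := by
    rw [hp]
    refine (totalDegree_C_mul_le _ _).trans (totalDegree_add_le_of_le ?_ ?_)
    · refine (totalDegree_C_mul_le _ _).trans ((totalDegree_pow _ _).trans ?_)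
      have := (hP.2 0).le
      omega
    · exact (totalDegree_C_mul_le _ _).trans ((hP.2 0).le.trans one_le_two)
  have hsub : ∀ i : Fin 3, i ≠ 2 → supported k {2} ≤ supported k ({i}ᶜ : Set (Fin 3)) :=
    fun i hi => supported_mono (by simpa using hi)
  -- Shifting `y` by `p` would also change `α*(z)`; shifting `x` by `b * p` as well compensates for
  -- this.
  obtain ⟨b, hb⟩ : ∃ b, A 2 0 * b + A 2 1 = 0 := ⟨-(A 2 1 / A 2 0), by field_simp; ring⟩
  obtain ⟨R, hR⟩ : ∃ R, R = Polynomial.aeval (X 2 : MvPolynomial (Fin 3) k) P.r := ⟨_, rfl⟩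
  obtain ⟨q, hq⟩ : ∃ q : MvPolynomial (Fin 3) k, q = X 2 * (X 1 + C P.ξ) := ⟨_, rfl⟩
  have hRs : ∀ {s : Set (Fin 3)}, 2 ∈ s → R ∈ supported k s := fun hs => hR ▸ P.r_mem_supported hs
  have hqs : ∀ {s : Set (Fin 3)}, 1 ∈ s → 2 ∈ s → q ∈ supported k s := fun h1 h2 =>
    hq ▸ mul_mem (X_mem_supported.2 h2)
      (add_mem (X_mem_supported.2 h1) (Subalgebra.algebraMap_mem _ _))
  have hbp : C b * p ∈ supported k {2} := mul_mem (Subalgebra.algebraMap_mem _ _) hps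
  set e := comp (elementary 0 (C b * p)) (elementary 1 p) with he
  set t := comp (elementary 1 R) (elementary 0 q) with ht
  have e0 : e 0 = X 0 + C b * p := by
    rw [he, comp_apply, elementary_same, map_add, aeval_X, elementary_of_ne (by decide),
      aeval_elementary (hsub 1 (by decide) hbp)]
  have e1 : e 1 = X 1 + p := by
    rw [he, comp_apply, elementary_of_ne (by decide), aeval_X, elementary_same]
  have e2 : e 2 = X 2 := by
    rw [he, comp_apply, elementary_of_ne (by decide), aeval_X, elementary_of_ne (by decide)]
  have t0 : t 0 = X 0 + q := by
    rw [ht, comp_apply, elementary_of_ne (by decide), aeval_X, elementary_same]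
  have t1 : t 1 = X 1 + R := by
    rw [ht, comp_apply, elementary_same, map_add, aeval_X, elementary_of_ne (by decide),
      aeval_elementary (hRs (by simp))]
  have t2 : t 2 = X 2 := by
    rw [ht, comp_apply, elementary_of_ne (by decide), aeval_X, elementary_of_ne (by decide)]
  have hαe : ∀ i, comp P.α e i = P.α i + C (A i 0 * b + A i 1) * p := by
    intro i
    rw [he, ← comp_assoc, comp_apply, hα, comp_affineMap_elementary, map_add, map_mul,
      aeval_C, aeval_elementary (hsub 1 (by decide) hbp), ← comp_apply, comp_affineMap_elementary,
      MvPolynomial.algebraMap_eq, C_add, C_mul]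
    ring
  set L : Endo k 3 := elementary 1 (C (P.a 4) * X 2) with hL
  have hLs : C (P.a 4) * X 2 ∈ supported k ({1}ᶜ : Set (Fin 3)) :=
    mul_mem (Subalgebra.algebraMap_mem _ _) (X_mem_supported.2 (by simp))
  have hLa : IsAffine L := isAffine_of_degree_le (isAut_elementary hLs)
    (degree_elementary_le le_rfl ((totalDegree_C_mul_le _ _).trans (totalDegree_X _).le))
  have hx : P.aPoly = C (P.a 0) * X 0 ^ 2 + C (P.a 3) * X 0 + C (P.a 4) * X 2 := by
    rw [aPoly, ha1, ha2, C_0]; ring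
  have h1 : comp (elementary 1 P.aPoly) P.α = comp (comp L P.α) e := by
    rw [comp_assoc]
    funext i
    rw [comp_apply, comp_apply]
    by_cases hi : i = 1
    · subst hi
      rw [hL, elementary_same, elementary_same, map_add, map_add, aeval_X, aeval_X, map_mul, aeval_X,
        hαe, hαe, hb, h10, hx]
      simp only [map_add, map_mul, map_pow, aeval_X, aeval_C, MvPolynomial.algebraMap_eq, C_0,
        zero_mul, zero_add]
      rw [hp']
      ring
    · rw [hL, elementary_of_ne hi, elementary_of_ne hi, aeval_X, aeval_X, hαe]
      have : A i 0 * b + A i 1 = 0 := by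
        fin_cases i
        · simp [h00, h01]
        · exact absurd rfl hi
        · exact hb
      rw [this, C_0, zero_mul, add_zero]
  have hg : P.g = comp t (elementary 1 P.aPoly) := by
    funext i
    have hR' : aeval (elementary 1 P.aPoly) R = R := aeval_elementary (hRs (by simp))
    have x2 : elementary 1 P.aPoly 2 = X 2 := elementary_of_ne (by decide) _
    rw [comp_apply]
    fin_cases i
    · change P.g 0 = aeval _ (t 0)
      rw [t0, hq]
      simp only [map_add, map_mul, aeval_X, aeval_C, elementary_same, x2,
        elementary_of_ne (show (0 : Fin 3) ≠ 1 by decide), g, Matrix.cons_val_zero,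
        MvPolynomial.algebraMap_eq]
      ring
    · change P.g 1 = aeval _ (t 1)
      rw [t1, map_add, hR', aeval_X, elementary_same, hR]
      rfl
    · change X 2 = aeval _ (t 2)
      rw [t2, aeval_X, x2]
  have h2 : comp (elementary 1 P.aPoly) (comp P.α t) = comp (comp L P.α) (comp e t) := by
    rw [← comp_assoc, h1, comp_assoc]
  have ht' : ∀ {s : MvPolynomial (Fin 3) k}, s ∈ supported k {2} → aeval t s = s := fun hs => by
    rw [aeval_congr_of_mem_supported hs (w := X)]
    · exact aeval_X_left_apply _
    · rintro i rfl
      exact t2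
  have τ0 : comp e t 0 = X 0 + q + C b * p := by
    rw [comp_apply, e0, map_add, aeval_X, t0, ht' hbp]
  have τ1 : comp e t 1 = X 1 + R + p := by rw [comp_apply, e1, map_add, aeval_X, t1, ht' hps]
  have τ2 : comp e t 2 = X 2 := by rw [comp_apply, e2, aeval_X, t2]
  have hτ : IsAut (comp e t) :=
    isAut_comp (isAut_comp (isAut_elementary (hsub 0 (by decide) hbp))
      (isAut_elementary (hsub 1 (by decide) hps)))
      (isAut_comp (isAut_elementary (hRs (by simp)))
        (isAut_elementary (hqs (by simp) (by simp))))
  refine ⟨elementary 1 P.aPoly, _, isConjBy_of_comp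
    (isInverse_elementary P.aPoly_mem_supported) (t := comp P.α t)
    (by rw [f, hg, comp_assoc P.α]), ?_, ?_⟩
  · refine ⟨comp L P.α, _, hLa.comp_isAffine hP, ⟨hτ, fun i => ?_⟩, h2⟩
    fin_cases i
    · change comp e t 0 ∈ supported k (Set.Ici 0)
      rw [show Set.Ici 0 = (Set.univ : Set (Fin 3)) from
        Set.eq_univ_of_forall fun i => Fin.zero_le i, supported_univ]
      trivial
    · change comp e t 1 ∈ _
      rw [τ1]
      refine add_mem (add_mem (X_mem_supported.2 ?_) (hRs ?_)) (supported_mono ?_ hps)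
      · exact Set.self_mem_Ici
      · simp
      · simp
    · change comp e t 2 ∈ _
      rw [τ2]
      exact X_mem_supported.2 Set.self_mem_Ici
  · rw [h2]
    refine (degree_comp_le _ _).trans (Nat.mul_le_mul (hLa.comp_isAffine hP).degree_le
      (Finset.sup_le (a := 3) fun i _ => ?_))
    have hX : ∀ i, (X i : MvPolynomial (Fin 3) k).totalDegree ≤ 1 := fun i => (totalDegree_X i).le
    have hX3 : ∀ i, (X i : MvPolynomial (Fin 3) k).totalDegree ≤ 3 := fun i =>
      (hX i).trans (by norm_num)
    fin_cases i
    · change (comp e t 0).totalDegree ≤ 3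
      rw [τ0, hq]
      refine totalDegree_add_le_of_le (totalDegree_add_le_of_le (hX3 0) ?_)
        ((totalDegree_C_mul_le _ _).trans (hpd.trans (by norm_num)))
      refine totalDegree_mul_le_of_le (M := 1) (N := 2) (hX 2)
        (totalDegree_add_le_of_le ((hX 1).trans (by norm_num)) ?_)
      rw [totalDegree_C]; norm_num
    · change (comp e t 1).totalDegree ≤ 3
      rw [τ1]
      refine totalDegree_add_le_of_le (totalDegree_add_le_of_le (hX3 1) ?_)
        (hpd.trans (by norm_num))
      rw [hR]
      exact (totalDegree_polynomial_aeval_le _ _).trans (by rw [totalDegree_X]; omega)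
    · change (comp e t 2).totalDegree ≤ 3
      rw [τ2]
      exact hX3 2

end Params

end

/-! ### Conjugation by shears, and reading off coefficients. -/

section

variable {k : Type*} [Field k]

namespace Params

/-- The affine automorphism `(x - b z, y - s x - t z, z)`. -/
def shearMap (b s t : k) : Endo k 3 :=
  ![X 0 - C b * X 2, X 1 - C s * X 0 - C t * X 2, X 2]

/-- The inverse of `shearMap b s t`. -/
def shearInv (b s t : k) : Endo k 3 :=
  ![X 0 + C b * X 2, X 1 + C s * (X 0 + C b * X 2) + C t * X 2, X 2]

theorem isInverse_shear (b s t : k) : IsInverse (shearMap b s t) (shearInv b s t) := by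
  constructor <;> funext i <;> fin_cases i <;>
    simp [comp_apply, shearMap, shearInv, idMap, -aeval_eq_bind₁] <;> ring

theorem degree_shearMap_le (b s t : k) : degree (shearMap b s t) ≤ 1 := by
  have hX : ∀ i, (X i : MvPolynomial (Fin 3) k).totalDegree ≤ 1 := fun i => (totalDegree_X i).le
  have h1 : ∀ (b : k) i, (C b * X i : MvPolynomial (Fin 3) k).totalDegree ≤ 1 := fun b i =>
    (totalDegree_C_mul_le _ _).trans (hX i)
  refine Finset.sup_le fun i _ => ?_
  fin_cases i
  · exact (totalDegree_sub _ _).trans (max_le (hX _) (h1 _ _))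
  · exact (totalDegree_sub _ _).trans (max_le ((totalDegree_sub _ _).trans
      (max_le (hX _) (h1 _ _))) (h1 _ _))
  · exact hX 2

theorem degree_shearInv_le (b s t : k) : degree (shearInv b s t) ≤ 1 := by
  have hX : ∀ i, (X i : MvPolynomial (Fin 3) k).totalDegree ≤ 1 := fun i => (totalDegree_X i).le
  have h1 : ∀ (b : k) i, (C b * X i : MvPolynomial (Fin 3) k).totalDegree ≤ 1 := fun b i =>
    (totalDegree_C_mul_le _ _).trans (hX i)
  refine Finset.sup_le fun i _ => ?_
  fin_cases i
  · exact totalDegree_add_le_of_le (hX _) (h1 _ _)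
  · exact totalDegree_add_le_of_le (totalDegree_add_le_of_le (hX _)
      ((totalDegree_C_mul_le _ _).trans (totalDegree_add_le_of_le (hX _) (h1 _ _)))) (h1 _ _)
  · exact hX 2

theorem isAffine_shearMap (b s t : k) : IsAffine (shearMap b s t) :=
  isAffine_of_degree_le ⟨_, isInverse_shear b s t⟩ (degree_shearMap_le b s t)

/-- The parameters of the conjugate of `f` by `shearMap b s t`. -/
def shear (P : Params k) (b s t : k) : Params k where
  α := comp (shearMap b s t) P.α
  ξ := P.ξ + b
  a := ![P.a 0, P.a 1 + 2 * b * P.a 0, P.a 2 + b * P.a 1 + b ^ 2 * P.a 0, P.a 3 + s,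
    P.a 4 + b * P.a 3 + s * b + t]
  r := P.r

/-- The family of maps `g` is stable under this substitution: the linear terms added to `y` enter
`a` in both components, and the `bz` added to `x` changes `ξ`. The outer shear can then be absorbed
by `α`. -/
theorem g_comp_shearInv (P : Params k) (b s t : k) :
    comp P.g (shearInv b s t) = (P.shear b s t).g := by
  have hr : aeval (shearInv b s t) (Polynomial.aeval (X 2 : MvPolynomial (Fin 3) k) P.r) =
      Polynomial.aeval (X 2) P.r := by
    rw [aeval_polynomial_aeval, aeval_X]; rfl
  have h0 : shearInv b s t 0 = X 0 + C b * X 2 := rfl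
  have h1 : shearInv b s t 1 = X 1 + C s * (X 0 + C b * X 2) + C t * X 2 := rfl
  have h2 : shearInv b s t 2 = X 2 := rfl
  funext i
  rw [comp_apply]
  fin_cases i
  · change aeval _ (X 0 + X 1 * X 2 + X 2 * P.aPoly + C P.ξ * X 2) =
      X 0 + X 1 * X 2 + X 2 * (P.shear b s t).aPoly + C (P.ξ + b) * X 2
    simp only [map_add, map_mul, aeval_X, aeval_C, h0, h1, h2, aPoly, shear,
      Matrix.cons_val, MvPolynomial.algebraMap_eq, map_pow, map_ofNat]
    ring
  · change aeval _ (X 1 + P.aPoly + Polynomial.aeval (X 2) P.r) =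
      X 1 + (P.shear b s t).aPoly + Polynomial.aeval (X 2) P.r
    simp only [map_add, hr, aeval_X, aeval_C, h0, h1, h2, aPoly, shear,
      Matrix.cons_val, MvPolynomial.algebraMap_eq, map_pow, map_mul, map_ofNat]
    ring
  · change aeval _ (X 2) = X 2
    rw [aeval_X, h2]

theorem f_shear (P : Params k) (b s t : k) :
    (P.shear b s t).f = comp (shearMap b s t) (comp P.f (shearInv b s t)) := by
  rw [f, ← g_comp_shearInv, f]
  simp only [comp_assoc, shear]

theorem isConjBy_shear (P : Params k) (b s t : k) :
    IsConjBy (shearMap b s t) P.f (P.shear b s t).f :=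
  ⟨_, isInverse_shear b s t, P.f_shear b s t⟩

theorem hasDynamicalDegree_shear_iff (P : Params k) (b s t : k) (l : ℝ) :
    HasDynamicalDegree P.f l ↔ HasDynamicalDegree (P.shear b s t).f l := by
  rw [HasDynamicalDegree, HasDynamicalDegree, f_shear]
  simp only [degree_iter_conj (isInverse_shear b s t) (degree_shearMap_le b s t)
    (degree_shearInv_le b s t)]

theorem Admissible.shear {P : Params k} (hP : P.Admissible) (b s t : k) :
    (P.shear b s t).Admissible := by
  refine ⟨(isAffine_shearMap b s t).comp_isAffine hP.1, hP.2.1, fun h => hP.2.2 ?_⟩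
  have h0 : P.a 0 = 0 := congrArg Prod.fst h
  have h1 : P.a 1 + 2 * b * P.a 0 = 0 := congrArg Prod.snd h
  rw [h0, mul_zero, add_zero] at h1
  rw [h0, h1]

theorem α_shear {P : Params k} {A : Matrix (Fin 3) (Fin 3) k} {c : Fin 3 → k}
    (hα : P.α = affineMap A c) (b s t : k) :
    (P.shear b s t).α = affineMap
      ![fun j => A 0 j - b * A 2 j, fun j => A 1 j - s * A 0 j - t * A 2 j, A 2]
      ![c 0 - b * c 2, c 1 - s * c 0 - t * c 2, c 2] := by
  change comp (shearMap b s t) P.α = _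
  rw [hα]
  funext i
  rw [comp_apply]
  fin_cases i <;>
    simp [shearMap, affineMap, Fin.sum_univ_three, -aeval_eq_bind₁] <;> ring

/-! ### Coefficients -/

/-- Restriction to the `z`-axis kills every monomial except the pure powers of `z`. -/
theorem coeff_aeval_axis (p : MvPolynomial (Fin 3) k) (N : ℕ) :
    (aeval (![0, 0, Polynomial.X] : Fin 3 → Polynomial k) p).coeff N =
      p.coeff (Finsupp.single 2 N) := by
  induction p using MvPolynomial.induction_on' with
  | monomial d c =>
    rw [aeval_monomial, Finsupp.prod_fintype _ _ (fun _ => pow_zero _), Fin.prod_univ_three,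
      coeff_monomial]
    by_cases h : d 0 = 0 ∧ d 1 = 0
    · have hd : d = Finsupp.single 2 N ↔ d 2 = N := by
        constructor
        · intro h; simp [h]
        · rintro rfl
          ext i
          fin_cases i <;> simp [h]
      simp [h, hd, Polynomial.coeff_X_pow, eq_comm]
    · rw [if_neg]
      · rcases not_and_or.1 h with h | h <;> simp [h]
      · rintro rfl
        simp at h
  | add p q hp hq => simp only [map_add, Polynomial.coeff_add, coeff_add, hp, hq]

theorem coeff_f_single (P : Params k) (hr : P.r.natDegree ≤ 3) {A : Matrix (Fin 3) (Fin 3) k}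
    {c : Fin 3 → k} (hα : P.α = affineMap A c) (i : Fin 3) :
    (P.f i).coeff (Finsupp.single 2 2) = A i 0 * P.a 4 + A i 1 * (P.a 2 + P.r.coeff 2) ∧
      (P.f i).coeff (Finsupp.single 2 3) = A i 0 * P.a 2 + A i 1 * P.r.coeff 3 := by
  have h : ∀ e : Fin 11 → k, cubic e (![0, 0, Polynomial.X] : Fin 3 → Polynomial k) =
      Polynomial.C (e 0) + Polynomial.C (e 3) * Polynomial.X ^ 1 +
        Polynomial.C (e 9) * Polynomial.X ^ 2 + Polynomial.C (e 7) * Polynomial.X ^ 3 := by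
    intro e
    simp [cubic, cubicMonomial, Fin.sum_univ_succ]
    ring
  rw [← coeff_aeval_axis, ← coeff_aeval_axis, P.aeval_f hr hα, h]
  simp only [Polynomial.coeff_add, Polynomial.coeff_C_mul_X_pow, Polynomial.coeff_C]
  simp [cubicCoeff]

theorem coeff_aPoly (P : Params k) (d : Fin 3 →₀ ℕ) :
    P.aPoly.coeff d = (if Finsupp.single 0 2 = d then P.a 0 else 0) +
      (if Finsupp.single 0 1 + Finsupp.single 2 1 = d then P.a 1 else 0) +
      (if Finsupp.single 2 2 = d then P.a 2 else 0) +
      (if Finsupp.single 0 1 = d then P.a 3 else 0) +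
      (if Finsupp.single 2 1 = d then P.a 4 else 0) := by
  have h : (X 2 : MvPolynomial (Fin 3) k) = monomial (Finsupp.single 2 1) 1 := rfl
  rw [aPoly, C_mul_X_pow_eq_monomial, C_mul_X_eq_monomial, C_mul_X_pow_eq_monomial,
    C_mul_X_eq_monomial, C_mul_X_eq_monomial, h, monomial_mul, mul_one]
  simp only [coeff_add, coeff_monomial]

theorem degreeOf_aPoly_of_ne_zero {P : Params k} (h : P.a 0 ≠ 0) :
    degreeOf 0 P.aPoly = 2 := by
  refine le_antisymm ((degreeOf_le_totalDegree _ _).trans P.totalDegree_aPoly_le) ?_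
  have := monomial_le_degreeOf 0 (f := P.aPoly) (m := Finsupp.single 0 2) (by
    rw [mem_support_iff, coeff_aPoly]
    simpa [Finsupp.ext_iff, Fin.forall_fin_succ] using h)
  simpa using this

theorem degreeOf_aPoly_of_eq_zero {P : Params k} (h : P.a 0 = 0) (h1 : P.a 1 ≠ 0) :
    degreeOf 0 P.aPoly = 1 := by
  refine le_antisymm ?_ ?_
  · rw [degreeOf_le_iff]
    intro d hd
    rw [mem_support_iff, coeff_aPoly, h, ite_self, zero_add] at hd
    by_contra h2
    refine hd ?_
    rw [if_neg, if_neg, if_neg, if_neg]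
    · simp
    all_goals
      rintro rfl
      simp at h2
  · have := monomial_le_degreeOf 0 (f := P.aPoly)
      (m := Finsupp.single 0 1 + Finsupp.single 2 1) (by
        rw [mem_support_iff, coeff_aPoly]
        simpa [Finsupp.ext_iff, Fin.forall_fin_succ] using h1)
    simpa using this

end Params

end

/-! ### The classification when `α*(z) ∉ k[z]`. -/

section

variable {k : Type*} [Field k]

namespace Params

theorem α_mem_supported_two_iff {P : Params k} {A : Matrix (Fin 3) (Fin 3) k} {c : Fin 3 → k}
    (hα : P.α = affineMap A c) (i : Fin 3) :
    P.α i ∈ supported k {2} ↔ A i 0 = 0 ∧ A i 1 = 0 := by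
  rw [hα, affineMap_mem_supported_iff]
  simp [Fin.forall_fin_succ]

theorem α_mem_supported_one_two_iff {P : Params k} {A : Matrix (Fin 3) (Fin 3) k} {c : Fin 3 → k}
    (hα : P.α = affineMap A c) (i : Fin 3) :
    P.α i ∈ supported k {1, 2} ↔ A i 0 = 0 := by
  rw [hα, affineMap_mem_supported_iff]
  simp [Fin.forall_fin_succ]

theorem coeff_three_ne_zero {P : Params k} (h : P.r.natDegree = 3) : P.r.coeff 3 ≠ 0 := by
  rw [← h]
  exact Polynomial.leadingCoeff_ne_zero.2 fun h0 => by simp [h0] at h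

theorem natDegree_le_two {P : Params k} (h : P.r.natDegree ≤ 3) (h3 : P.r.coeff 3 = 0) :
    P.r.natDegree ≤ 2 := by
  by_contra hlt
  exact coeff_three_ne_zero (by omega) h3

/-- The conclusion for `α*(z) ∉ k[z]`. -/
theorem classification [IsAlgClosed k] {P : Params k} (hP : P.Admissible)
    (h2 : P.α 2 ∉ supported k {2}) :
    (IsAlgebraicallyStable P.f ∧ HasDynamicalDegree P.f 3) ∨
      (∃ φ h : Endo k 3, IsConjBy φ P.f h ∧ IsAffineTriangular h ∧ degree h ≤ 3) ∨
      ∃ b s t : k, (P.shear b s t).Case1 ∨ (P.shear b s t).Case2 ∨ (P.shear b s t).Case3 ∨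
        (P.shear b s t).Case4 := by
  obtain ⟨A, c, hα, hA⟩ := hP.1.exists_eq_affineMap
  have hdet := det_fin_three_ne_zero hA
  have hr := hP.2.1
  have ha : P.a 0 ≠ 0 ∨ P.a 1 ≠ 0 := by
    by_contra! h
    exact hP.2.2 (Prod.ext h.1 h.2)
  rw [α_mem_supported_two_iff hα] at h2
  have hsr : ∀ b s t, (P.shear b s t).r = P.r := fun _ _ _ => rfl
  -- This says `q_2 ≠ 0`. The next two splits ask whether `q_0 = b * q_2`, and whether `q_2(b, 1) =
  -- 0`.
  by_cases h0 : A 2 0 ≠ 0 ∨ A 2 1 * P.r.coeff 3 ≠ 0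
  · by_cases hb : ∃ b : k, A 0 0 = b * A 2 0 ∧ A 0 1 * P.r.coeff 3 = b * (A 2 1 * P.r.coeff 3)
    · obtain ⟨b, hb0, hb1⟩ := hb
      by_cases hv : A 2 0 * (P.a 0 * b ^ 2 + P.a 1 * b + P.a 2) + A 2 1 * P.r.coeff 3 = 0
      · by_cases hr3 : P.r.coeff 3 = 0
        · have hr2 := natDegree_le_two hr hr3
          have h20 : A 2 0 ≠ 0 := h0.resolve_right (by simp [hr3])
          have ha2 : P.a 2 + b * P.a 1 + b ^ 2 * P.a 0 = 0 := by
            rw [hr3, mul_zero, add_zero] at hv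
            linear_combination (mul_eq_zero.1 hv).resolve_left h20
          by_cases h01 : A 0 1 - b * A 2 1 = 0
          · obtain ⟨t, ht⟩ : ∃ t, A 1 0 - t * A 2 0 = 0 := ⟨A 1 0 / A 2 0, by field_simp; ring⟩
            have hα' := α_shear hα b 0 t
            by_cases ha1 : P.a 1 + 2 * b * P.a 0 = 0
            · obtain ⟨φ, h, hc, hh⟩ := exists_conj_affineTriangular_of_rows
                (P := P.shear b 0 t) hr2 (hP.shear b 0 t).1 hα'
                (by simp [hb0]) (by simp [h01]) (by simp [ht])
                (fun h => hdet (by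
                  have h11 : A 1 1 - t * A 2 1 = 0 := by simpa using h
                  rw [hb0, sub_eq_zero.1 h01, sub_eq_zero.1 ht, sub_eq_zero.1 h11]
                  ring)) h20 ha1 ha2
              exact .inr (.inl ⟨_, h, (P.isConjBy_shear b 0 t).trans hc, hh⟩)
            · refine .inr (.inr ⟨b, 0, t, .inr (.inr (.inr ⟨hr2, ?_, ?_, ha1, ha2⟩))⟩)
              · rw [α_mem_supported_two_iff hα']
                simp [hb0, h01]
              · rw [α_mem_supported_one_two_iff hα']
                simp [ht]
          · obtain ⟨s, t, hs, ht⟩ : ∃ s t, A 1 0 - s * A 0 0 - t * A 2 0 = 0 ∧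
                A 1 1 - s * A 0 1 - t * A 2 1 = 0 := by
              obtain ⟨e, he⟩ : ∃ e, A 0 1 = e + b * A 2 1 := ⟨_, (sub_add_cancel _ _).symm⟩
              have he0 : e ≠ 0 := fun h => h01 (by rw [he, h]; ring)
              -- Subtracting `A 1 0 / A 2 0` times row 2 clears the first entry of row 1. The
              -- multiple `s` of row 0 minus `b` times row 2, which begins with `(0, e)`, then
              -- clears the second.
              refine ⟨(A 1 1 - A 1 0 / A 2 0 * A 2 1) / e,
                A 1 0 / A 2 0 - (A 1 1 - A 1 0 / A 2 0 * A 2 1) / e * b, ?_, ?_⟩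
              · rw [hb0]
                field_simp
                ring
              · rw [he]
                field_simp
                ring
            have hα' := α_shear hα b s t
            refine .inr (.inr ⟨b, s, t, .inr (.inr (.inl ⟨hr2, ?_, ?_, ha2⟩))⟩)
            · rw [α_mem_supported_two_iff hα']
              simp [hs, ht]
            · rw [α_mem_supported_one_two_iff hα']
              simp [hb0]
        · have h01 : A 0 1 - b * A 2 1 = 0 := by
            refine (mul_eq_zero.1 (?_ : (A 0 1 - b * A 2 1) * P.r.coeff 3 = 0)).resolve_right hr3
            linear_combination hb1
          have hr3' : P.r.natDegree = 3 :=
            le_antisymm hr (Polynomial.le_natDegree_of_ne_zero hr3)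
          have hα' := α_shear hα b 0 0
          refine .inr (.inr ⟨b, 0, 0, .inl ⟨hr3', ?_, ?_⟩⟩)
          · rw [α_mem_supported_two_iff hα']
            simp [hb0, h01]
          · rw [((P.shear b 0 0).coeff_f_single hr hα' 2).2, hsr]
            simp [shear]
            linear_combination hv
      · exact .inl (stable_of_dependent hr hα hb0 hb1 hv)
    · refine .inl (stable_of_independent hr ha hα h0 fun b => ?_)
      by_contra! h
      exact hb ⟨b, by linear_combination h.1, by linear_combination h.2⟩
  · push Not at h0
    -- Now `q_2 = 0`; since `α*(z) ∉ k[z]`, the entry `A 2 1` is nonzero, and this forces `r_3 = 0`.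
    have h21 : A 2 1 ≠ 0 := fun h => h2 ⟨h0.1, h⟩
    have hr2 := natDegree_le_two hr ((mul_eq_zero.1 h0.2).resolve_left h21)
    by_cases h00 : A 0 0 = 0
    · refine .inr (.inl (exists_conj_affineTriangular_of_col hr2 hP.1 hα h00 h0.1 fun h10 => ?_))
      exact hdet (by rw [h00, h0.1, h10]; ring)
    · obtain ⟨s, hs⟩ : ∃ s, A 1 0 - s * A 0 0 = 0 := ⟨A 1 0 / A 0 0, by field_simp; ring⟩
      obtain ⟨t, ht⟩ : ∃ t, A 1 1 - s * A 0 1 - t * A 2 1 = 0 :=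
        ⟨(A 1 1 - s * A 0 1) / A 2 1, by field_simp; ring⟩
      have hα' := α_shear hα 0 s t
      refine .inr (.inr ⟨0, s, t, .inr (.inl ⟨hr2, ?_, ?_⟩)⟩)
      · rw [α_mem_supported_two_iff hα']
        simp [h0.1, hs, ht]
      · rw [α_mem_supported_one_two_iff hα']
        simp [h0.1]

end Params

end

end AffineSpace

end

theorem mainTheorem7 {k : Type*} [Field k] [IsAlgClosed k]
    (P : AffineSpace.Params k) (hP : P.Admissible) :
    AffineSpace.IsAut P.f ∧
    -- the case `α*(z) ∈ k[z]`
    (P.α 2 ∈ MvPolynomial.supported k {2} →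
      AffineSpace.HasDynamicalDegree P.f (MvPolynomial.degreeOf 0 P.aPoly : ℝ) ∧
      (MvPolynomial.degreeOf 0 P.aPoly = 1 ∨ MvPolynomial.degreeOf 0 P.aPoly = 2)) ∧
    -- the case `α*(z) ∉ k[z]`
    (P.α 2 ∉ MvPolynomial.supported k {2} →
      (AffineSpace.IsAlgebraicallyStable P.f ∧ AffineSpace.HasDynamicalDegree P.f 3) ∨
      (∃ φ h : AffineSpace.Endo k 3, AffineSpace.IsConjBy φ P.f h ∧
        AffineSpace.IsAffineTriangular h ∧ AffineSpace.degree h ≤ 3) ∨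
      (∃ (κ : AffineSpace.Endo k 3) (Q : AffineSpace.Params k),
        AffineSpace.IsAffine κ ∧ Q.Admissible ∧ AffineSpace.IsConjBy κ P.f Q.f ∧
        (∀ l : ℝ, AffineSpace.HasDynamicalDegree P.f l ↔ AffineSpace.HasDynamicalDegree Q.f l) ∧
        (Q.Case1 ∨ Q.Case2 ∨ Q.Case3 ∨ Q.Case4))) ∧
    -- the dynamical degrees in the four cases
    (P.Case1 →
      (P.a 1 ≠ 0 → AffineSpace.HasDynamicalDegree P.f (1 + √2)) ∧
      (P.a 1 = 0 → AffineSpace.HasDynamicalDegree P.f ((1 + √13) / 2))) ∧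
    (P.Case2 →
      (P.a 0 ≠ 0 → AffineSpace.HasDynamicalDegree P.f (1 + √3)) ∧
      (P.a 0 = 0 → AffineSpace.HasDynamicalDegree P.f (1 + √2))) ∧
    (P.Case3 →
      (P.a 1 ≠ 0 → P.ε ≠ 0 → AffineSpace.HasDynamicalDegree P.f (1 + √3)) ∧
      (P.a 1 ≠ 0 → P.ε = 0 → AffineSpace.HasDynamicalDegree P.f ((3 + √5) / 2)) ∧
      (P.a 1 = 0 → P.ε ≠ 0 → AffineSpace.HasDynamicalDegree P.f ((1 + √17) / 2)) ∧
      (P.a 1 = 0 → P.ε = 0 → AffineSpace.HasDynamicalDegree P.f 2)) ∧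
    (P.Case4 → AffineSpace.HasDynamicalDegree P.f (1 + √2)) := by
  obtain ⟨A, c, hα, hA⟩ := hP.1.exists_eq_affineMap
  have hr := hP.2.1
  have ha : P.a 0 ≠ 0 ∨ P.a 1 ≠ 0 := by
    by_contra! h
    exact hP.2.2 (Prod.ext h.1 h.2)
  have hr3 : P.r.natDegree ≤ 2 → P.r.coeff 3 = 0 := fun h =>
    Polynomial.coeff_eq_zero_of_natDegree_lt (by omega)
  have hf := P.isAut_f hP.1
  refine ⟨hf, fun h => ?_, fun h => ?_, fun h => ?_, fun h => ?_, fun h => ?_, fun h => ?_⟩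
  · rw [AffineSpace.Params.α_mem_supported_two_iff hα] at h
    by_cases ha0 : P.a 0 = 0
    · rw [AffineSpace.Params.degreeOf_aPoly_of_eq_zero ha0 (ha.resolve_left (not_not.2 ha0))]
      refine ⟨?_, .inl rfl⟩
      rw [Nat.cast_one]
      exact AffineSpace.Params.hasDynamicalDegree_one_of_row hf hr hα ha0 h.1 h.2
    · rw [AffineSpace.Params.degreeOf_aPoly_of_ne_zero ha0]
      refine ⟨?_, .inr rfl⟩
      rw [Nat.cast_ofNat]
      exact AffineSpace.Params.hasDynamicalDegree_two_of_row hr hα hA ha0 h.1 h.2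
  · rcases AffineSpace.Params.classification hP h with h | h | ⟨b, s, t, h⟩
    · exact .inl h
    · exact .inr (.inl h)
    · exact .inr (.inr ⟨_, P.shear b s t, AffineSpace.Params.isAffine_shearMap b s t,
        hP.shear b s t, P.isConjBy_shear b s t, P.hasDynamicalDegree_shear_iff b s t, h⟩)
  · obtain ⟨h1, h2, h3⟩ := h
    rw [AffineSpace.Params.α_mem_supported_two_iff hα] at h2
    rw [(P.coeff_f_single hr hα 2).2] at h3
    exact AffineSpace.Params.hasDynamicalDegree_case1 hr
      (AffineSpace.Params.coeff_three_ne_zero h1) ha hα hA h2.1 h2.2 h3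
  · obtain ⟨h1, h2, h3⟩ := h
    rw [AffineSpace.Params.α_mem_supported_two_iff hα] at h2
    rw [AffineSpace.Params.α_mem_supported_one_two_iff hα] at h3
    exact AffineSpace.Params.hasDynamicalDegree_case2 hr hα hA (hr3 h1) ha h2.1 h2.2 h3
  · obtain ⟨h1, h2, h3, h4⟩ := h
    rw [AffineSpace.Params.α_mem_supported_two_iff hα] at h2
    rw [AffineSpace.Params.α_mem_supported_one_two_iff hα] at h3
    have h01 : A 0 1 ≠ 0 := fun h =>
      AffineSpace.det_fin_three_ne_zero hA (by rw [h, h2.1, h2.2, h3]; ring)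
    -- In Case 3, `A 0 0 = 0` and `a_2 = 0`, so `ε = A 0 1 * r_2` with `A 0 1 ≠ 0`.
    have hε : P.ε = 0 ↔ P.r.coeff 2 = 0 := by
      rw [AffineSpace.Params.ε, (P.coeff_f_single hr hα 0).1, h3, h4]
      simp [h01]
    simpa only [ne_eq, hε] using
      AffineSpace.Params.hasDynamicalDegree_case3 hr hα hA (hr3 h1) ha h4 h2.1 h2.2 h3
  · obtain ⟨h1, h2, h3, h4, h5⟩ := h
    rw [AffineSpace.Params.α_mem_supported_two_iff hα] at h2
    rw [AffineSpace.Params.α_mem_supported_one_two_iff hα] at h3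
    exact AffineSpace.Params.hasDynamicalDegree_case4 hr hα hA (hr3 h1) h4 h5 h2.1 h2.2 h3
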